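/- **Setting.** Consider the linear system $dx=(Ax+B_1u_1+B_2u_2)\,dt+G\,dW$ with running payoff $x^\top Qx+u_1^\top R_1u_1-u_2^\top R_2u_2$, where $Q\succeq 0$ and $R_1,R_2\succ 0$. Let $P$ be the minimal positive-semidefinite solution of $A^\top P+PA+Q+P(B_2R_2^{-1}B_2^\top-B_1R_1^{-1}B_1^\top)P=0$. Put $\tilde A=A+B_2R_2^{-1}B_2^\top P$, $M_1=PB_1R_1^{-1}B_1^\top P$, $\Phi(t)=e^{\tilde At}$. For a sampling step $h>0$ let $\tilde G^h=\int_0^h\Phi(s)GG^\top\Phi(s)^\top ds$ and $$U(\Delta)=\mathrm{tr}\Big(M_1\sum_{i=0}^{\Delta-1}\Phi(ih)\,\tilde G^h\,\Phi(ih)^\top\Big),\qquad \Delta\in\mathbb N_0 .$$ The age of information $\Delta_k$ starts at a given $\Delta_0\in\mathbb N_0$. At each step a sensing policy $\mu$ (possibly randomized and history-dependent) chooses $\delta_k\in\{0,1\}$, and $\Delta_{k+1}=1$ if $\delta_k=1$, $\Delta_{k+1}=\Delta_k+1$ if $\delta_k=0$. For a budget $b>0$ with $bh\le 1$, the constrained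 problem is to minimize $$\bar J^h(\mu)=\limsup_{m\to\infty}\frac1m\,\mathbb E\Big[\sum_{k=0}^mU(\Delta_k)\Big]\quad\text{subject to}\quad \limsup_{m\to\infty}\frac1{mh}\,\mathbb E\Big[\sum_{k=0}^m\delta_k\Big]\le b .$$ For $\lambda\ge 0$ and $\beta\in(0,1)$, a threshold $\eta\in\mathbb N_0\cup\{\infty\}$ is called $\beta$-optimal if the policy $\delta_k=\mathbb I[\Delta_k\ge\eta]$ minimizes $\mathbb E\sum_{k\ge0}\beta^k(U(\Delta_k)+\lambda\delta_k)$ from every initial age. We write $\bar\eta_\lambda$ for any limit of $\beta_\ell$-optimal thresholds along a sequence $\beta_\ell\to1$ in $(0,1)$. An optimal Lagrange multiplier is a maximizer over $\lambda\ge 0$ of the dual function $$\lambda\mapsto\inf_\mu\,\limsup_{m\to\infty}\frac1m\,\mathbb E\Big[\sum_{k=0}^m(U(\Delta_k)+\lambda\delta_k)\Big]-\lambda bh .$$ For $\varepsilon>0$, an $\varepsilon$-bracket consists of $0\le\lambda_1\le\lambda_2<\lambda_1+\varepsilon$ and thresholds $\bar\eta_{\lambda_1},\bar\eta_{\lambda_2}$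 such that $b_2\le b\le b_1$, where $b_i$ is the budget (the left side of the constraint) that the policy $\delta_k=\mathbb I[\Delta_k\ge\bar\eta_{\lambda_i}]$ uses. **Proposition.** 1. For every $\varepsilon>0$ there is an $\varepsilon$-bracket with $b_2<b_1$. 2. There is an $\varepsilon_0>0$ such that, for every $\varepsilon_0$-bracket, the interval $[\lambda_1,\lambda_2]$ contains an optimal Lagrange multiplier, and the following holds. If $b_2<b_1$, the randomized threshold policy $$\delta_k^*=\mathbb I\big[\Delta_k\ge\vartheta\,\bar\eta_{\lambda_1}+(1-\vartheta)\,\bar\eta_{\lambda_2}\big],\qquad \vartheta\sim\mathrm{Bernoulli}\Big(\frac{b-b_2}{b_1-b_2}\Big),$$ with $\vartheta$ drawn once (so that threshold $\bar\eta_{\lambda_1}$ is used if $\vartheta=1$ and $\bar\eta_{\lambda_2}$ if $\vartheta=0$), is optimal for the constrained problem among all sensing policies. If $b_1=b_2$, the deterministic threshold policies with thresholds $\bar\eta_{\lambda_1}$ and $\bar\eta_{\lambda_2}$ are both optimal. 3. Randomization is needed in general: if $1/(bh)$ is not an integer and $U(1)<U(2)$, then no stationary deterministic policy $\delta_k=f(\Delta_k)$,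 $f:\mathbb N_0\to\{0,1\}$, is optimal for the constrained problem. -/

import Mathlib

open MeasureTheory Filter Topology
open scoped Matrix ENNReal NNReal

noncomputable section

namespace SensingGame

/-- Data of the two-player linear-quadratic game
`dx = (A x + B₁ u₁ + B₂ u₂) dt + G dW`, with running payoff `xᵀQx + u₁ᵀR₁u₁ - u₂ᵀR₂u₂`. -/
structure LQGame (n m₁ m₂ p : ℕ) where
  A : Matrix (Fin n) (Fin n) ℝ
  B₁ : Matrix (Fin n) (Fin m₁) ℝ
  B₂ : Matrix (Fin n) (Fin m₂) ℝ
  G : Matrix (Fin n) (Fin p) ℝ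
  Q : Matrix (Fin n) (Fin n) ℝ
  R₁ : Matrix (Fin m₁) (Fin m₁) ℝ
  R₂ : Matrix (Fin m₂) (Fin m₂) ℝ
  Q_posSemidef : Q.PosSemidef
  R₁_posDef : R₁.PosDef
  R₂_posDef : R₂.PosDef

variable {n m₁ m₂ p : ℕ}

/-- `P` is a positive-semidefinite solution of the generalized algebraic Riccati equation. -/
def LQGame.IsRiccatiSolution (S : LQGame n m₁ m₂ p) (P : Matrix (Fin n) (Fin n) ℝ) : Prop :=
  P.PosSemidef ∧
    S.Aᵀ * P + P * S.A + S.Q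
      + P * (S.B₂ * S.R₂⁻¹ * S.B₂ᵀ - S.B₁ * S.R₁⁻¹ * S.B₁ᵀ) * P = 0

/-- `P` is the minimal positive-semidefinite solution (in the Loewner order). -/
def LQGame.IsMinimalRiccatiSolution (S : LQGame n m₁ m₂ p)
    (P : Matrix (Fin n) (Fin n) ℝ) : Prop :=
  S.IsRiccatiSolution P ∧ ∀ P', S.IsRiccatiSolution P' → (P' - P).PosSemidef

/-- Closed-loop drift `Ã = A + B₂ R₂⁻¹ B₂ᵀ P` once the second player uses its security strategy. -/
def LQGame.driftTilde (S : LQGame n m₁ m₂ p) (P : Matrix (Fin n) (Fin n) ℝ) :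
    Matrix (Fin n) (Fin n) ℝ :=
  S.A + S.B₂ * S.R₂⁻¹ * S.B₂ᵀ * P

/-- Error weight `M₁ = P B₁ R₁⁻¹ B₁ᵀ P`. -/
def LQGame.errorWeight (S : LQGame n m₁ m₂ p) (P : Matrix (Fin n) (Fin n) ℝ) :
    Matrix (Fin n) (Fin n) ℝ :=
  P * S.B₁ * S.R₁⁻¹ * S.B₁ᵀ * P

/-- Transition matrix `Φ(t) = exp (Ã t)`. -/
def LQGame.transition (S : LQGame n m₁ m₂ p) (P : Matrix (Fin n) (Fin n) ℝ) (t : ℝ) :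
    Matrix (Fin n) (Fin n) ℝ :=
  NormedSpace.exp (t • S.driftTilde P)

/-- `G̃ʰ = ∫₀ʰ Φ(s) G Gᵀ Φ(s)ᵀ ds`, the integral being taken entry by entry. -/
def LQGame.noiseGramian (S : LQGame n m₁ m₂ p) (P : Matrix (Fin n) (Fin n) ℝ) (h : ℝ) :
    Matrix (Fin n) (Fin n) ℝ :=
  Matrix.of fun i j =>
    ∫ s in (0 : ℝ)..h, (S.transition P s * S.G * S.Gᵀ * (S.transition P s)ᵀ) i j

/-- The stage cost at age `d`: `U(d) = tr (M₁ ∑_{i < d} Φ(ih) G̃ʰ Φ(ih)ᵀ)`. -/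
def LQGame.ageCost (S : LQGame n m₁ m₂ p) (P : Matrix (Fin n) (Fin n) ℝ) (h : ℝ) (d : ℕ) : ℝ :=
  (S.errorWeight P *
    ∑ i ∈ Finset.range d,
      S.transition P (i * h) * S.noiseGramian P h * (S.transition P (i * h))ᵀ).trace

/-- A (possibly randomized, history-dependent) sensing policy. The sample point `ω ∈ Ω` carries all
the randomness that a decision may depend on: the private randomization of the policy and the
primitive randomness (initial state, driving noise) behind the sensed states. The list holds the
ages of information seen so far, the current one first; it is equivalent to the record of past
sensing instants. The value `true` means that a sensing takes place. -/
structure SensingPolicy where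
  Ω : Type
  [measurableSpace : MeasurableSpace Ω]
  prob : Measure Ω
  [isProbabilityMeasure : IsProbabilityMeasure prob]
  act : Ω → List ℕ → Bool
  measurable_act : ∀ l : List ℕ, Measurable fun ω => act ω l

attribute [instance] SensingPolicy.measurableSpace SensingPolicy.isProbabilityMeasure

namespace SensingPolicy

/-- The ages `[Δ_k, …, Δ_0]` when the policy `μ` starts from `Δ_0 = d`: the next age is `1` after a
sensing, and grows by one otherwise. -/
def history (μ : SensingPolicy) (d : ℕ) (ω : μ.Ω) : ℕ → List ℕ
  | 0 => [d]
  | k + 1 =>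
      (if μ.act ω (μ.history d ω k) then 1 else (μ.history d ω k).headI + 1) :: μ.history d ω k

/-- The age of information `Δ_k`. -/
def age (μ : SensingPolicy) (d : ℕ) (ω : μ.Ω) (k : ℕ) : ℕ := (μ.history d ω k).headI

/-- The sensing action `δ_k ∈ {0, 1}`. -/
def action (μ : SensingPolicy) (d : ℕ) (ω : μ.Ω) (k : ℕ) : ℝ≥0∞ :=
  if μ.act ω (μ.history d ω k) then 1 else 0

/-- `limsup_m (1/m) E ∑_{k=0}^m (U(Δ_k) + lam δ_k)`, for a nonnegative stage cost `U`. -/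
def lagrangianCost (U : ℕ → ℝ) (lam : ℝ≥0) (μ : SensingPolicy) (d : ℕ) : ℝ≥0∞ :=
  limsup (fun m : ℕ =>
    (∫⁻ ω, ∑ k ∈ Finset.range (m + 1),
      (ENNReal.ofReal (U (μ.age d ω k)) + lam * μ.action d ω k) ∂μ.prob) / (m : ℝ≥0∞)) atTop

/-- The average cost `limsup_m (1/m) E ∑_{k=0}^m U(Δ_k)`. -/
def averageCost (U : ℕ → ℝ) (μ : SensingPolicy) (d : ℕ) : ℝ≥0∞ :=
  limsup (fun m : ℕ =>
    (∫⁻ ω, ∑ k ∈ Finset.range (m + 1), ENNReal.ofReal (U (μ.age d ω k)) ∂μ.prob)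
      / (m : ℝ≥0∞)) atTop

/-- The average number of sensings per unit of time, `limsup_m E[n(m)] / (m h)`, where
`n(m) = ∑_{k=0}^m δ_k` counts the sensings at the times `0, h, …, m h`. -/
def sensingRate (h : ℝ) (μ : SensingPolicy) (d : ℕ) : ℝ≥0∞ :=
  limsup (fun m : ℕ =>
    (∫⁻ ω, ∑ k ∈ Finset.range (m + 1), μ.action d ω k ∂μ.prob) / ENNReal.ofReal (m * h)) atTop

/-- The discounted Lagrangian cost `E ∑_k β^k (U(Δ_k) + lam δ_k)` from the initial age `d`. -/
def discountedCost (U : ℕ → ℝ) (β : ℝ) (lam : ℝ≥0) (μ : SensingPolicy) (d : ℕ) : ℝ≥0∞ :=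
  ∫⁻ ω, ∑' k : ℕ, ENNReal.ofReal (β ^ k) *
    (ENNReal.ofReal (U (μ.age d ω k)) + lam * μ.action d ω k) ∂μ.prob

/-- The stationary deterministic policy `δ_k = f (Δ_k)`. -/
def stationary (f : ℕ → Bool) : SensingPolicy where
  Ω := Unit
  prob := Measure.dirac ()
  act := fun _ l => f l.headI
  measurable_act := fun _ => measurable_const

/-- The threshold policy `δ_k = 𝕀[Δ_k ≥ η]`; the threshold `⊤` means that no sensing is made. -/
def threshold (η : ℕ∞) : SensingPolicy :=
  stationary fun d => decide (η ≤ (d : ℕ∞))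

/-- The policy `δ_k = 𝕀[Δ_k ≥ ϑ η₁ + (1 - ϑ) η₂]`, where `ϑ` is a `{0, 1}`-valued random variable
that is drawn once and for all. -/
def mixedThreshold {Ω : Type} [MeasurableSpace Ω] (ℙ : Measure Ω) [IsProbabilityMeasure ℙ]
    (ϑ : Ω → Bool) (hϑ : Measurable ϑ) (η₁ η₂ : ℕ∞) : SensingPolicy where
  Ω := Ω
  prob := ℙ
  act := fun ω l => decide ((if ϑ ω then η₁ else η₂) ≤ (l.headI : ℕ∞))
  measurable_act := fun l =>
    (measurable_from_top (f := fun t : Bool =>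
      decide ((if t then η₁ else η₂) ≤ (l.headI : ℕ∞)))).comp hϑ

end SensingPolicy

open SensingPolicy

/-- `μ` solves the constrained problem: it minimizes the average cost among all the sensing
policies whose sensing rate is at most `b`, from the initial age `d`. -/
def IsConstrainedOptimal (U : ℕ → ℝ) (h b : ℝ) (d : ℕ) (μ : SensingPolicy) : Prop :=
  μ.sensingRate h d ≤ ENNReal.ofReal b ∧
    ∀ μ' : SensingPolicy, μ'.sensingRate h d ≤ ENNReal.ofReal b →
      μ.averageCost U d ≤ μ'.averageCost U d

/-- The value function `V_{β,lam}` of the discounted problem. -/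
def discountedValue (U : ℕ → ℝ) (β : ℝ) (lam : ℝ≥0) (d : ℕ) : ℝ≥0∞ :=
  ⨅ μ : SensingPolicy, μ.discountedCost U β lam d

/-- The threshold `η` is `β`-optimal: its policy attains the value function at every age. -/
def IsDiscountOptimalThreshold (U : ℕ → ℝ) (β : ℝ) (lam : ℝ≥0) (η : ℕ∞) : Prop :=
  ∀ d : ℕ, (threshold η).discountedCost U β lam d = discountedValue U β lam d

/-- `η` is a threshold `η̄_lam`: a limit of `β_l`-optimal thresholds along some sequence of
discount factors `β_l` in `(0, 1)` that tends to `1`. -/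
def IsLimitThreshold (U : ℕ → ℝ) (lam : ℝ≥0) (η : ℕ∞) : Prop :=
  ∃ (β : ℕ → ℝ) (θ : ℕ → ℕ∞),
    (∀ l, 0 < β l ∧ β l < 1) ∧ Tendsto β atTop (𝓝 1) ∧
    (∀ l, IsDiscountOptimalThreshold U (β l) lam (θ l)) ∧ Tendsto θ atTop (𝓝 η)

/-- The Lagrange dual function: the optimal average Lagrangian cost minus `lam * (b h)`, where
`b h` is the number of sensings allowed per step. -/
def dualValue (U : ℕ → ℝ) (h b : ℝ) (d : ℕ) (lam : ℝ≥0) : ℝ :=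
  (⨅ μ : SensingPolicy, μ.lagrangianCost U lam d).toReal - lam * (b * h)

/-- `lam` is an optimal Lagrange multiplier: it maximizes the dual function over `[0, ∞)`. -/
def IsOptimalMultiplier (U : ℕ → ℝ) (h b : ℝ) (d : ℕ) (lam : ℝ≥0) : Prop :=
  ∀ lam' : ℝ≥0, dualValue U h b d lam' ≤ dualValue U h b d lam

/-- The budget (sensings per unit of time) utilized by the threshold policy `η`. -/
def budgetUsed (h : ℝ) (d : ℕ) (η : ℕ∞) : ℝ := ((threshold η).sensingRate h d).toReal

/-- `[lam₁, lam₂]`, with thresholds `η₁` at `lam₁` and `η₂` at `lam₂`, is an admissible outcome of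
the bisection with tolerance `ε`: the interval is shorter than `ε`, and the budget `b` lies between
the budgets that the two thresholds utilize. -/
structure IsBracket (U : ℕ → ℝ) (h b : ℝ) (d : ℕ) (ε : ℝ) (lam₁ lam₂ : ℝ≥0) (η₁ η₂ : ℕ∞) :
    Prop where
  le : lam₁ ≤ lam₂
  lt : (lam₂ : ℝ) < lam₁ + ε
  limit₁ : IsLimitThreshold U lam₁ η₁
  limit₂ : IsLimitThreshold U lam₂ η₂
  budget₂_le : budgetUsed h d η₂ ≤ b
  le_budget₁ : b ≤ budgetUsed h d η₁

end SensingGame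

end

/-!
Of the linear-quadratic game only one fact matters: the age cost `U` vanishes at `0` and is
monotone, since its increments are traces of products of positive-semidefinite matrices
(`LQGame.monotone_ageCost`). The rest concerns an arbitrary such `U`.

Between two sensings the age runs through a cycle `1, …, L` of cost `S(L) = U(1) + ⋯ + U(L)`. If each
sensing is charged `lam`, the mean cost of cycles of length `L` is `(S(L) + lam) / L`. As `U` is
monotone, the length `N` minimizes it exactly if `T(N - 1) ≤ lam ≤ T(N)`, where the nondecreasing
sequence `T(M) = M U(M + 1) - S(M)` (`switchCharge`) lists the charges at which the lengths `M` and
`M + 1` are equally good (`IsOptimalLength.cycleMean_mul_le`). A price `g` per step with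
`g L ≤ S(L) + lam` for all `L` is a lower bound on the Lagrangian cost of every sample path, by a
potential argument that counts the excess of the current cycle (`IsAgePath.exists_le_sum`).
Integration gives weak duality: every policy within the budget `b` has average cost at least
`g - lam b h` (`SensingPolicy.ofReal_sub_le_averageCost`). Threshold policies and their mixtures have
explicit costs, as their ages are eventually periodic, and attain this bound when their mean
frequency is `b h` and their cycle lengths are optimal for the charge (`mixedThreshold_le`).

Limits of discount-optimal thresholds are optimal cycle lengths: the discounted costs are compared
with those of the other thresholds, and the discount factor tends to `1`
(`IsLimitThreshold.isOptimalLength`, `IsLimitThreshold.switchCharge_le`). Conversely, a verification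
argument along sample paths shows that the thresholds needed for a bracket are discount-optimal
(`isLimitThreshold_natCast`, `isDiscountOptimalThreshold_top`).

Let `N` be the integer part of `1 / (b h)`. Just below the charge `T(N)` some length `k ≤ N` is
optimal, just above it some length `k > N` or the threshold `⊤`; this yields brackets. Conversely, in
a bracket shorter than the gap of the values of `T` around `T(N)`, either one of the thresholds
exhausts the budget and carries all the probability, or both thresholds are optimal at the common
charge `T(N)` (`IsBracket.exists_common_gain`). Finally, a stationary deterministic policy within the
budget has cycles longer than `N` if `1 / (b h)` is not an integer, and the mixture of the thresholds
`N` and `N + 1` is strictly cheaper because `T(N) ≥ T(1) = U(2) - U(1) > 0`.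
-/

namespace SensingGame

/-! ### Monotonicity of the age cost -/

open scoped MatrixOrder Matrix.Norms.L2Operator in
theorem trace_mul_nonneg_of_posSemidef {k : ℕ} {X Y : Matrix (Fin k) (Fin k) ℝ}
    (hX : X.PosSemidef) (hY : Y.PosSemidef) : 0 ≤ (X * Y).trace := by
  obtain ⟨K, rfl⟩ := CStarAlgebra.nonneg_iff_eq_star_mul_self.mp hX.nonneg
  rw [Matrix.star_eq_conjTranspose, Matrix.mul_assoc, Matrix.trace_mul_comm]
  exact (hY.mul_mul_conjTranspose_same K).trace_nonneg

theorem posSemidef_of_integral {k : ℕ} {F : ℝ → Matrix (Fin k) (Fin k) ℝ} (hF : Continuous F)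
    (hpos : ∀ s, (F s).PosSemidef) {h : ℝ} (hh : 0 ≤ h) :
    (Matrix.of fun i j => ∫ s in (0 : ℝ)..h, F s i j).PosSemidef := by
  have hint : ∀ i j, IntervalIntegrable (fun s => F s i j) volume 0 h := fun i j =>
    (hF.matrix_elem i j).intervalIntegrable 0 h
  refine Matrix.PosSemidef.of_dotProduct_mulVec_nonneg ?_ fun x => ?_
  · ext i j
    simp only [Matrix.conjTranspose_apply, Matrix.of_apply, star_trivial]
    exact intervalIntegral.integral_congr fun s _ => by
      simpa using (hpos s).isHermitian.apply i j
  · have key : star x ⬝ᵥ (Matrix.of fun i j => ∫ s in (0 : ℝ)..h, F s i j) *ᵥ x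
        = ∫ s in (0 : ℝ)..h, star x ⬝ᵥ (F s) *ᵥ x := by
      simp only [dotProduct, Matrix.mulVec, Matrix.of_apply, Finset.mul_sum]
      have hterm : ∀ i j, IntervalIntegrable (fun s => star x i * (F s i j * x j)) volume 0 h :=
        fun i j => ((hint i j).mul_const _).const_mul _
      have hrow : ∀ i, IntervalIntegrable (fun s => ∑ j, star x i * (F s i j * x j)) volume 0 h :=
        fun i => (continuous_finsetSum _ fun j _ =>
          ((hF.matrix_elem i j).mul_const _).const_mul _).intervalIntegrable 0 h
      rw [intervalIntegral.integral_finsetSum fun i _ => hrow i]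
      refine Finset.sum_congr rfl fun i _ => ?_
      rw [intervalIntegral.integral_finsetSum fun j _ => hterm i j]
      refine Finset.sum_congr rfl fun j _ => ?_
      rw [intervalIntegral.integral_const_mul, intervalIntegral.integral_mul_const]
    rw [key]
    exact intervalIntegral.integral_nonneg hh fun s _ => (hpos s).dotProduct_mulVec_nonneg x

namespace LQGame

variable {n m₁ m₂ p : ℕ} (S : LQGame n m₁ m₂ p) (P : Matrix (Fin n) (Fin n) ℝ)

theorem continuous_transition : Continuous (S.transition P) := by
  let : NormedRing (Matrix (Fin n) (Fin n) ℝ) := Matrix.linftyOpNormedRing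
  let : NormedAlgebra ℝ (Matrix (Fin n) (Fin n) ℝ) := Matrix.linftyOpNormedAlgebra
  let : NormedAlgebra ℚ (Matrix (Fin n) (Fin n) ℝ) := NormedAlgebra.restrictScalars ℚ ℝ _
  exact NormedSpace.exp_continuous.comp (continuous_id.smul continuous_const)

theorem noiseGramian_posSemidef {h : ℝ} (hh : 0 ≤ h) : (S.noiseGramian P h).PosSemidef := by
  refine posSemidef_of_integral
    (F := fun s => S.transition P s * S.G * S.Gᵀ * (S.transition P s)ᵀ) ?_ (fun s => ?_) hh
  · have := S.continuous_transition P
    fun_prop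
  · have h1 := Matrix.posSemidef_self_mul_conjTranspose (S.transition P s * S.G)
    rwa [Matrix.conjTranspose_mul, ← Matrix.mul_assoc, Matrix.conjTranspose_eq_transpose_of_trivial,
      Matrix.conjTranspose_eq_transpose_of_trivial] at h1

variable {P}

theorem errorWeight_posSemidef (hP : P.PosSemidef) : (S.errorWeight P).PosSemidef := by
  have h1 := S.R₁_posDef.posSemidef.inv.mul_mul_conjTranspose_same (P * S.B₁)
  rwa [Matrix.conjTranspose_mul, hP.isHermitian.eq, ← Matrix.mul_assoc,
    Matrix.conjTranspose_eq_transpose_of_trivial] at h1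

@[simp] theorem ageCost_zero (h : ℝ) : S.ageCost P h 0 = 0 := by simp [ageCost]

theorem monotone_ageCost (hP : P.PosSemidef) {h : ℝ} (hh : 0 ≤ h) :
    Monotone (S.ageCost P h) := by
  refine monotone_nat_of_le_succ fun d => ?_
  rw [ageCost, ageCost, Finset.sum_range_succ, Matrix.mul_add, Matrix.trace_add]
  refine le_add_of_nonneg_right (trace_mul_nonneg_of_posSemidef (S.errorWeight_posSemidef hP) ?_)
  simpa [Matrix.conjTranspose_eq_transpose_of_trivial] using
    (S.noiseGramian_posSemidef P hh).mul_mul_conjTranspose_same (S.transition P (d * h))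

end LQGame

/-! ### Age sequences and their undiscounted costs -/

/-- The ages `a k` evolve according to the decisions `δ k`. -/
def IsAgePath (a : ℕ → ℕ) (δ : ℕ → Bool) : Prop :=
  ∀ k, a (k + 1) = if δ k then 1 else a k + 1

/-- The cost `U(1) + ⋯ + U(L)` of the ages in a cycle of length `L`, that is, between two sensings
`L` steps apart. -/
def cycleCost (U : ℕ → ℝ) (L : ℕ) : ℝ := ∑ j ∈ Finset.range L, U (j + 1)

@[simp] theorem cycleCost_zero (U : ℕ → ℝ) : cycleCost U 0 = 0 := by simp [cycleCost]

theorem cycleCost_succ (U : ℕ → ℝ) (L : ℕ) :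
    cycleCost U (L + 1) = cycleCost U L + U (L + 1) := by
  simp [cycleCost, Finset.sum_range_succ]

/-- A price `g` per step that no cycle can undercut, at the charge `lam` per sensing, is a lower
bound on the long-run Lagrangian cost per step of *every* age sequence. -/
theorem IsAgePath.exists_le_sum {U : ℕ → ℝ} (hU0 : U 0 = 0) {g lam : ℝ} (hg : 0 ≤ g)
    (hcycle : ∀ L : ℕ, g * L ≤ cycleCost U L + lam) (d : ℕ) :
    ∃ K, ∀ {a : ℕ → ℕ} {δ : ℕ → Bool}, IsAgePath a δ → a 0 = d → ∀ m : ℕ,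
      g * m - K ≤ ∑ k ∈ Finset.range m, (U (a k) + lam * if δ k then 1 else 0) := by
  -- `φ a` is the excess, over the price `g`, of the cost paid so far in the current cycle.
  let φ : ℕ → ℝ := fun a => cycleCost U a - U a - g * a + g
  have hφ : ∀ a, φ (a + 1) = cycleCost U a - g * a := fun a => by
    simp only [φ, cycleCost_succ]; push_cast; ring
  have hlam : 0 ≤ lam := by simpa using hcycle 0
  have hφlow : ∀ a, -lam ≤ φ a := by
    rintro (_ | a)
    · simp only [φ, cycleCost_zero, hU0]; simp; linarith
    · rw [hφ]; linarith [hcycle a]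
  refine ⟨φ d + lam, fun {a δ} ha h0 m => ?_⟩
  have key : g * m + φ (a m) - φ d
      ≤ ∑ k ∈ Finset.range m, (U (a k) + lam * if δ k then 1 else 0) := by
    induction m with
    | zero => simp [h0]
    | succ m ih =>
      rw [Finset.sum_range_succ, ha m]
      have hstep : φ (a m) = cycleCost U (a m) - U (a m) - g * a m + g := rfl
      split_ifs with hδ
      · have h1 := hφ 0
        simp only [zero_add, cycleCost_zero, Nat.cast_zero, mul_zero, sub_zero] at h1
        rw [h1]
        push_cast
        linarith [hcycle (a m)]
      · rw [hφ]
        push_cast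
        linarith
  linarith [hφlow (a m)]

/-- One step of the age under the rule `δ = f(Δ)`. -/
def nextAge (f : ℕ → Bool) (a : ℕ) : ℕ := if f a then 1 else a + 1

theorem nextAge_of_true {f : ℕ → Bool} {a : ℕ} (h : f a = true) : nextAge f a = 1 := by
  simp [nextAge, h]

theorem nextAge_of_false {f : ℕ → Bool} {a : ℕ} (h : f a = false) : nextAge f a = a + 1 := by
  simp [nextAge, h]

theorem exists_iterate_nextAge_eq_one {f : ℕ → Bool} (i : ℕ) :
    ∀ d : ℕ, f (d + i) = true → ∃ k, (nextAge f)^[k] d = 1 := by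
  induction i with
  | zero => exact fun d h => ⟨1, by simpa using nextAge_of_true h⟩
  | succ i ih =>
    intro d h
    cases hd : f d
    · obtain ⟨k, hk⟩ := ih (d + 1) (by rwa [add_assoc, add_comm 1 i])
      exact ⟨k + 1, by rw [Function.iterate_succ_apply, nextAge_of_false hd, hk]⟩
    · exact ⟨1, by simpa using nextAge_of_true hd⟩

theorem iterate_nextAge_of_forall_false {f : ℕ → Bool} {d : ℕ}
    (h : ∀ i, f (d + i) = false) (k : ℕ) : (nextAge f)^[k] d = d + k := by
  induction k with
  | zero => rfl
  | succ k ih => rw [Function.iterate_succ_apply', ih, nextAge_of_false (h k), add_assoc]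

/-- `L` is the first age, from age `1` on, at which the rule `f` senses. -/
structure IsCycleLength (f : ℕ → Bool) (L : ℕ) : Prop where
  pos : 0 < L
  sense : f L = true
  wait : ∀ j, 0 < j → j < L → f j = false

/-- Once the age has been reset, the rule `f` runs through the ages `1, …, L` periodically, so that
the sums of any function of the age grow at the rate of its mean over a cycle. -/
theorem IsCycleLength.exists_abs_sum_sub_le {f : ℕ → Bool} {L : ℕ} (hf : IsCycleLength f L)
    {d k₀ : ℕ} (hk₀ : (nextAge f)^[k₀] d = 1) (c : ℕ → ℝ) :
    ∃ K, ∀ m : ℕ, |∑ k ∈ Finset.range m, c ((nextAge f)^[k] d) - cycleCost c L / L * m| ≤ K := by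
  set g := cycleCost c L / L with hg
  have hLpos : (0 : ℝ) < L := by exact_mod_cast hf.pos
  let ψ : ℕ → ℝ := fun i => cycleCost (fun j => c j - g) i
  have hψL : ψ L = 0 := by
    simp only [ψ, cycleCost, Finset.sum_sub_distrib, Finset.sum_const, Finset.card_range,
      nsmul_eq_mul]
    rw [hg, cycleCost]
    field_simp
    ring
  have key : ∀ m, ∃ i < L, (nextAge f)^[k₀ + m] d = i + 1 ∧
      ∑ k ∈ Finset.range m, (c ((nextAge f)^[k₀ + k] d) - g) = ψ i := by
    intro m
    induction m with
    | zero => exact ⟨0, hf.pos, by simpa using hk₀, by simp [ψ]⟩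
    | succ m ih =>
      obtain ⟨i, hi, hai, hsum⟩ := ih
      have hsum' : ∑ k ∈ Finset.range (m + 1), (c ((nextAge f)^[k₀ + k] d) - g) = ψ (i + 1) := by
        rw [Finset.sum_range_succ, hsum, hai]
        simp [ψ, cycleCost_succ]
      rw [← add_assoc, Function.iterate_succ_apply', hai]
      rcases (Nat.succ_le_of_lt hi).lt_or_eq with h | h
      · exact ⟨i + 1, h, nextAge_of_false (hf.wait _ (by omega) h), hsum'⟩
      · refine ⟨0, hf.pos, nextAge_of_true (by rw [show i + 1 = L from h]; exact hf.sense), ?_⟩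
        rw [hsum', show i + 1 = L from h, hψL]
        simp [ψ]
  let e : ℕ → ℝ := fun k => c ((nextAge f)^[k] d) - g
  refine ⟨∑ k ∈ Finset.range k₀, |e k| + ∑ i ∈ Finset.range L, |ψ i|, fun m => ?_⟩
  have hrw : ∑ k ∈ Finset.range m, c ((nextAge f)^[k] d) - g * m = ∑ k ∈ Finset.range m, e k := by
    simp [e, Finset.sum_sub_distrib, mul_comm]
  rw [hrw]
  have hψnn : 0 ≤ ∑ i ∈ Finset.range L, |ψ i| := Finset.sum_nonneg fun _ _ => abs_nonneg _
  rcases le_total m k₀ with h | h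
  · refine (Finset.abs_sum_le_sum_abs _ _).trans ?_
    have := Finset.sum_le_sum_of_subset_of_nonneg (Finset.range_mono h)
      fun i _ _ => abs_nonneg (e i)
    linarith
  · obtain ⟨r, rfl⟩ := Nat.exists_eq_add_of_le h
    obtain ⟨i, hi, -, hsum⟩ := key r
    rw [Finset.sum_range_add, show ∑ x ∈ Finset.range r, e (k₀ + x) = ψ i from hsum]
    refine (abs_add_le _ _).trans (add_le_add (Finset.abs_sum_le_sum_abs _ _) ?_)
    exact Finset.single_le_sum (f := fun i => |ψ i|) (fun _ _ => abs_nonneg _)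
      (Finset.mem_range.mpr hi)

/-! ### Expected costs of sensing policies -/

namespace SensingPolicy

variable (μ : SensingPolicy) (d : ℕ)

theorem age_zero (ω : μ.Ω) : μ.age d ω 0 = d := rfl

theorem isAgePath (ω : μ.Ω) :
    IsAgePath (μ.age d ω) fun k => μ.act ω (μ.history d ω k) := fun _ => rfl

theorem measurableSet_history_eq (k : ℕ) (l : List ℕ) :
    MeasurableSet {ω | μ.history d ω k = l} := by
  induction k generalizing l with
  | zero => simp [history]
  | succ k ih =>
    cases l with
    | nil => simp [history]
    | cons x l =>
      have : {ω | μ.history d ω (k + 1) = x :: l} = {ω | μ.history d ω k = l} ∩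
          {ω | (if μ.act ω l then 1 else l.headI + 1) = x} := by
        ext ω
        simp only [history, List.cons.injEq, Set.mem_ofPred_eq, Set.mem_inter_iff]
        constructor
        · rintro ⟨h1, h2⟩
          exact ⟨h2, h2 ▸ h1⟩
        · rintro ⟨h1, h2⟩
          exact ⟨h1 ▸ h2, h1⟩
      rw [this]
      exact (ih l).inter ((measurable_from_top
        (f := fun t : Bool => if t then 1 else l.headI + 1)).comp (μ.measurable_act l)
          (measurableSet_singleton x))

theorem measurable_action (k : ℕ) : Measurable fun ω => μ.action d ω k := by
  let : MeasurableSpace (List ℕ) := ⊤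
  have : DiscreteMeasurableSpace (List ℕ) := ⟨fun _ => trivial⟩
  have hhist : Measurable fun ω => μ.history d ω k :=
    measurable_to_countable' fun l => μ.measurableSet_history_eq d k l
  have hact : Measurable fun q : μ.Ω × List ℕ => μ.act q.1 q.2 :=
    measurable_from_prod_countable_left fun l => μ.measurable_act l
  exact (measurable_from_top (f := fun t : Bool => if t then (1 : ℝ≥0∞) else 0)).comp
    (hact.comp (measurable_id.prodMk hhist))

@[simp] theorem age_stationary (f : ℕ → Bool) (ω : Unit) (k : ℕ) :
    (stationary f).age d ω k = (nextAge f)^[k] d := by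
  induction k with
  | zero => rfl
  | succ k ih => rw [Function.iterate_succ_apply', ← ih]; rfl

theorem action_stationary (f : ℕ → Bool) (ω : Unit) (k : ℕ) :
    (stationary f).action d ω k = if f ((nextAge f)^[k] d) then 1 else 0 := by
  rw [← age_stationary d f ω k]; rfl

end SensingPolicy

/-! ### Linear growth rates in the extended nonnegative reals -/

theorem tendsto_ofReal_linear_div {s : ℝ} (hs : 0 < s) (x K : ℝ) :
    Tendsto (fun m : ℕ => ENNReal.ofReal (x * m + K) / ENNReal.ofReal (m * s)) atTop
      (𝓝 (ENNReal.ofReal (x / s))) := by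
  have h1 : Tendsto (fun m : ℕ => x / s + K / s * (1 / (m : ℝ))) atTop (𝓝 (x / s + K / s * 0)) :=
    (tendsto_one_div_atTop_nhds_zero_nat.const_mul _).const_add _
  rw [mul_zero, add_zero] at h1
  refine ((ENNReal.continuous_ofReal.tendsto _).comp h1).congr' ?_
  filter_upwards [eventually_gt_atTop 0] with m hm
  have hm' : (0 : ℝ) < m := by exact_mod_cast hm
  rw [← ENNReal.ofReal_div_of_pos (by positivity), Function.comp_apply]
  congr 1
  field_simp

theorem limsup_div_le_of_le_linear {s : ℝ} (hs : 0 < s) {x K : ℝ} {F : ℕ → ℝ≥0∞}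
    (hF : ∀ m : ℕ, F m ≤ ENNReal.ofReal (x * m + K)) :
    limsup (fun m : ℕ => F m / ENNReal.ofReal (m * s)) atTop ≤ ENNReal.ofReal (x / s) := by
  rw [← (tendsto_ofReal_linear_div hs x K).limsup_eq]
  exact limsup_le_limsup (Eventually.of_forall fun m => ENNReal.div_le_div_right (hF m) _)

theorem le_limsup_div_of_linear_le {s : ℝ} (hs : 0 < s) {x K : ℝ} {F : ℕ → ℝ≥0∞}
    (hF : ∀ᶠ m : ℕ in atTop, ENNReal.ofReal (x * m + K) ≤ F m) :
    ENNReal.ofReal (x / s) ≤ limsup (fun m : ℕ => F m / ENNReal.ofReal (m * s)) atTop := by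
  rw [← (tendsto_ofReal_linear_div hs x K).limsup_eq]
  exact limsup_le_limsup (hF.mono fun m hm => ENNReal.div_le_div_right hm _)

namespace SensingPolicy

variable (μ : SensingPolicy) (d : ℕ)

/-- The expected cost `E ∑_{k=0}^m U(Δ_k)`. -/
noncomputable def totalCost (U : ℕ → ℝ) (m : ℕ) : ℝ≥0∞ :=
  ∫⁻ ω, ∑ k ∈ Finset.range (m + 1), ENNReal.ofReal (U (μ.age d ω k)) ∂μ.prob

/-- The expected number of sensings `E ∑_{k=0}^m δ_k`. -/
noncomputable def totalSensings (m : ℕ) : ℝ≥0∞ :=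
  ∫⁻ ω, ∑ k ∈ Finset.range (m + 1), μ.action d ω k ∂μ.prob

theorem averageCost_eq (U : ℕ → ℝ) :
    μ.averageCost U d
      = limsup (fun m : ℕ => μ.totalCost d U m / ENNReal.ofReal (m * 1)) atTop := by
  simp [averageCost, totalCost]

theorem sensingRate_eq (h : ℝ) :
    μ.sensingRate h d
      = limsup (fun m : ℕ => μ.totalSensings d m / ENNReal.ofReal (m * h)) atTop := rfl

theorem lintegral_lagrangian_eq (U : ℕ → ℝ) (lam : ℝ≥0) (m : ℕ) :
    ∫⁻ ω, ∑ k ∈ Finset.range (m + 1),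
        (ENNReal.ofReal (U (μ.age d ω k)) + lam * μ.action d ω k) ∂μ.prob
      = μ.totalCost d U m + lam * μ.totalSensings d m := by
  have hmeas : Measurable fun ω => ∑ k ∈ Finset.range (m + 1), μ.action d ω k :=
    Finset.measurable_fun_sum _ fun k _ => μ.measurable_action d k
  simp only [Finset.sum_add_distrib, ← Finset.mul_sum]
  rw [lintegral_add_right _ (hmeas.const_mul _), lintegral_const_mul _ hmeas]
  rfl

theorem lagrangianCost_eq (U : ℕ → ℝ) (lam : ℝ≥0) :
    μ.lagrangianCost U lam d = limsup (fun m : ℕ =>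
      (μ.totalCost d U m + lam * μ.totalSensings d m) / ENNReal.ofReal (m * 1)) atTop := by
  simp only [lagrangianCost, lintegral_lagrangian_eq]
  simp

theorem stageCost_eq_ofReal {U : ℕ → ℝ} (hU : ∀ j, 0 ≤ U j) (lam : ℝ≥0) (ω : μ.Ω) (k : ℕ) :
    ENNReal.ofReal (U (μ.age d ω k)) + lam * μ.action d ω k
      = ENNReal.ofReal (U (μ.age d ω k) + lam * if μ.act ω (μ.history d ω k) then 1 else 0) := by
  rw [ENNReal.ofReal_add (hU _) (by positivity), ENNReal.ofReal_mul lam.coe_nonneg,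
    ENNReal.ofReal_coe_nnreal]
  congr 2
  rw [action]
  split_ifs <;> simp

theorem exists_linear_le_totalLagrangian {U : ℕ → ℝ} (hU0 : U 0 = 0) (hU : ∀ j, 0 ≤ U j) {g : ℝ}
    (hg : 0 ≤ g) {lam : ℝ≥0} (hcycle : ∀ L : ℕ, g * L ≤ cycleCost U L + lam) :
    ∃ K, ∀ m : ℕ,
      ENNReal.ofReal (g * m + K) ≤ μ.totalCost d U m + lam * μ.totalSensings d m := by
  obtain ⟨K, hK⟩ := IsAgePath.exists_le_sum hU0 hg hcycle d
  refine ⟨g - K, fun m => ?_⟩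
  rw [← lintegral_lagrangian_eq]
  calc ENNReal.ofReal (g * m + (g - K))
      = ∫⁻ _, ENNReal.ofReal (g * m + (g - K)) ∂μ.prob := by simp
    _ ≤ _ := lintegral_mono fun ω => ?_
  simp only [μ.stageCost_eq_ofReal d hU]
  rw [← ENNReal.ofReal_sum_of_nonneg fun k _ => add_nonneg (hU _) (by positivity)]
  refine ENNReal.ofReal_le_ofReal (le_trans (le_of_eq ?_)
    (hK (μ.isAgePath d ω) (μ.age_zero d ω) (m + 1)))
  push_cast
  ring

theorem ofReal_le_lagrangianCost {U : ℕ → ℝ} (hU0 : U 0 = 0) (hU : ∀ j, 0 ≤ U j) {g : ℝ}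
    (hg : 0 ≤ g) {lam : ℝ≥0} (hcycle : ∀ L : ℕ, g * L ≤ cycleCost U L + lam) :
    ENNReal.ofReal g ≤ μ.lagrangianCost U lam d := by
  obtain ⟨K, hK⟩ := μ.exists_linear_le_totalLagrangian d hU0 hU hg hcycle
  rw [lagrangianCost_eq, ← div_one g]
  exact le_limsup_div_of_linear_le one_pos (Eventually.of_forall hK)

/-- Weak duality: a price `g` that no cycle can undercut at the charge `lam` bounds the average cost
of every policy that respects the budget. -/
theorem ofReal_sub_le_averageCost {U : ℕ → ℝ} (hU0 : U 0 = 0) (hU : ∀ j, 0 ≤ U j) {g : ℝ}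
    (hg : 0 ≤ g) {lam : ℝ≥0} (hcycle : ∀ L : ℕ, g * L ≤ cycleCost U L + lam) {h b : ℝ}
    (hh : 0 < h) (hb : 0 < b) (hrate : μ.sensingRate h d ≤ ENNReal.ofReal b) :
    ENNReal.ofReal (g - lam * (b * h)) ≤ μ.averageCost U d := by
  obtain ⟨K, hK⟩ := μ.exists_linear_le_totalLagrangian d hU0 hU hg hcycle
  -- The budget is only met in the limit, so it is first relaxed to `b + ε`.
  have relaxed : ∀ ε : ℝ, 0 < ε →
      ENNReal.ofReal (g - lam * ((b + ε) * h)) ≤ μ.averageCost U d := by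
    intro ε hε
    have hlt : limsup (fun m : ℕ => μ.totalSensings d m / ENNReal.ofReal (m * h)) atTop
        < ENNReal.ofReal (b + ε) := by
      rw [← sensingRate_eq]
      exact hrate.trans_lt ((ENNReal.ofReal_lt_ofReal_iff (by linarith)).mpr (by linarith))
    rw [averageCost_eq, ← div_one (g - lam * ((b + ε) * h))]
    refine le_limsup_div_of_linear_le (K := K) one_pos ?_
    filter_upwards [eventually_lt_of_limsup_lt hlt, eventually_gt_atTop 0] with m hm hm0
    have hmh : 0 < (m : ℝ) * h := mul_pos (by exact_mod_cast hm0) hh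
    have hcount : μ.totalSensings d m ≤ ENNReal.ofReal ((b + ε) * (m * h)) := by
      rw [ENNReal.ofReal_mul (by linarith)]
      exact (ENNReal.div_le_iff (ENNReal.ofReal_pos.mpr hmh).ne' ENNReal.ofReal_ne_top).mp hm.le
    have h2 : ENNReal.ofReal (g * m + K)
        ≤ μ.totalCost d U m + ENNReal.ofReal (lam * ((b + ε) * (m * h))) := by
      rw [ENNReal.ofReal_mul lam.coe_nonneg, ENNReal.ofReal_coe_nnreal]
      exact (hK m).trans (by gcongr)
    rw [← tsub_le_iff_right, ← ENNReal.ofReal_sub _ (by positivity)] at h2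
    refine le_trans (le_of_eq ?_) h2
    congr 1
    ring
  have hlim : Tendsto (fun ε : ℝ => ENNReal.ofReal (g - lam * ((b + ε) * h))) (𝓝[>] 0)
      (𝓝 (ENNReal.ofReal (g - lam * ((b + 0) * h)))) := by
    refine Tendsto.mono_left
      ((ENNReal.continuous_ofReal.comp ?_).tendsto 0) nhdsWithin_le_nhds
    fun_prop
  rw [add_zero] at hlim
  exact le_of_tendsto hlim (eventually_mem_nhdsWithin.mono relaxed)

end SensingPolicy

open SensingPolicy

/-! ### Threshold policies -/

/-- The decision rule of the threshold policy `η`. -/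
def thresholdRule (η : ℕ∞) (a : ℕ) : Bool := decide (η ≤ (a : ℕ∞))

theorem threshold_eq_stationary (η : ℕ∞) : threshold η = stationary (thresholdRule η) := rfl

/-- The sum of a function of the age over the times `0, …, m - 1` under the rule `f`. -/
noncomputable def orbitSum (f : ℕ → Bool) (d : ℕ) (c : ℕ → ℝ) (m : ℕ) : ℝ :=
  ∑ k ∈ Finset.range m, c ((nextAge f)^[k] d)

/-- The indicator of the ages at which the rule `f` senses. -/
noncomputable def senseIndicator (f : ℕ → Bool) (a : ℕ) : ℝ := if f a then 1 else 0

theorem orbitSum_nonneg {f : ℕ → Bool} {c : ℕ → ℝ} (hc : ∀ j, 0 ≤ c j) (d m : ℕ) :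
    0 ≤ orbitSum f d c m := Finset.sum_nonneg fun _ _ => hc _

theorem senseIndicator_nonneg (f : ℕ → Bool) (a : ℕ) : 0 ≤ senseIndicator f a := by
  unfold senseIndicator; positivity

theorem totalCost_stationary {U : ℕ → ℝ} (hU : ∀ j, 0 ≤ U j) (f : ℕ → Bool) (d m : ℕ) :
    (stationary f).totalCost d U m = ENNReal.ofReal (orbitSum f d U (m + 1)) := by
  refine (lintegral_dirac (α := Unit) () _).trans ?_
  rw [orbitSum, ENNReal.ofReal_sum_of_nonneg fun _ _ => hU _]
  exact Finset.sum_congr rfl fun k _ => congrArg (fun a => ENNReal.ofReal (U a))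
    (age_stationary d f () k)

theorem totalSensings_stationary (f : ℕ → Bool) (d m : ℕ) :
    (stationary f).totalSensings d m
      = ENNReal.ofReal (orbitSum f d (senseIndicator f) (m + 1)) := by
  refine (lintegral_dirac (α := Unit) () _).trans ?_
  rw [orbitSum, ENNReal.ofReal_sum_of_nonneg fun _ _ => senseIndicator_nonneg _ _]
  refine Finset.sum_congr rfl fun k _ => (action_stationary d f () k).trans ?_
  rw [senseIndicator]
  split_ifs <;> simp

theorem IsCycleLength.cycleCost_senseIndicator {f : ℕ → Bool} {L : ℕ} (hf : IsCycleLength f L) :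
    cycleCost (senseIndicator f) L = 1 := by
  obtain ⟨l, rfl⟩ := Nat.exists_eq_add_of_le' hf.pos
  rw [cycleCost_succ, senseIndicator, if_pos hf.sense, cycleCost, Finset.sum_eq_zero, zero_add]
  intro j hj
  have := Finset.mem_range.mp hj
  simp [senseIndicator, hf.wait (j + 1) (by omega) (by omega)]

theorem isCycleLength_thresholdRule (k : ℕ) : IsCycleLength (thresholdRule k) (max k 1) where
  pos := by omega
  sense := by simp [thresholdRule]
  wait j h0 hj := by
    simp only [thresholdRule, Nat.cast_le, decide_eq_false_iff_not]
    omega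

theorem exists_iterate_thresholdRule_eq_one (k d : ℕ) :
    ∃ k₀, (nextAge (thresholdRule k))^[k₀] d = 1 :=
  exists_iterate_nextAge_eq_one k d (by simp [thresholdRule])

theorem thresholdRule_top (a : ℕ) : thresholdRule ⊤ a = false := by simp [thresholdRule]

/-- The long-run number of sensings per step under the threshold `η`. The thresholds `0` and `1`
both sense at every step, except possibly at time `0`. -/
noncomputable def sensingFrequency : ℕ∞ → ℝ
  | ⊤ => 0
  | (k : ℕ) => 1 / (max k 1 : ℕ)

@[simp] theorem sensingFrequency_top : sensingFrequency ⊤ = 0 := rfl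

@[simp] theorem sensingFrequency_coe (k : ℕ) :
    sensingFrequency (k : ℕ∞) = 1 / (max k 1 : ℕ) := rfl

theorem exists_abs_sensings_sub_le (η : ℕ∞) (d : ℕ) :
    ∃ K, ∀ m : ℕ, |orbitSum (thresholdRule η) d (senseIndicator (thresholdRule η)) m
      - sensingFrequency η * m| ≤ K := by
  induction η using ENat.recTopCoe with
  | top =>
    refine ⟨0, fun m => ?_⟩
    simp [orbitSum, senseIndicator, thresholdRule_top]
  | coe k =>
    obtain ⟨k₀, hk₀⟩ := exists_iterate_thresholdRule_eq_one k d
    have hL := isCycleLength_thresholdRule k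
    obtain ⟨K, hK⟩ := hL.exists_abs_sum_sub_le hk₀ (senseIndicator (thresholdRule k))
    rw [hL.cycleCost_senseIndicator] at hK
    exact ⟨K, hK⟩

theorem sensingRate_stationary_of_abs_le {f : ℕ → Bool} {d : ℕ} {h r K : ℝ} (hh : 0 < h)
    (hK : ∀ m : ℕ, |orbitSum f d (senseIndicator f) m - r * m| ≤ K) :
    (stationary f).sensingRate h d = ENNReal.ofReal (r / h) := by
  rw [sensingRate_eq]
  simp only [totalSensings_stationary]
  apply le_antisymm
  · refine limsup_div_le_of_le_linear (K := r + K) hh fun m => ENNReal.ofReal_le_ofReal ?_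
    have := (abs_le.mp (hK (m + 1))).2
    push_cast at this
    linarith
  · refine le_limsup_div_of_linear_le (K := r - K) hh (Eventually.of_forall fun m =>
      ENNReal.ofReal_le_ofReal ?_)
    have := (abs_le.mp (hK (m + 1))).1
    push_cast at this
    linarith

theorem sensingFrequency_nonneg (η : ℕ∞) : 0 ≤ sensingFrequency η := by
  induction η using ENat.recTopCoe with
  | top => simp
  | coe k => rw [sensingFrequency_coe]; positivity

theorem budgetUsed_eq {h : ℝ} (hh : 0 < h) (d : ℕ) (η : ℕ∞) :
    budgetUsed h d η = sensingFrequency η / h := by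
  obtain ⟨K, hK⟩ := exists_abs_sensings_sub_le η d
  rw [budgetUsed, threshold_eq_stationary, sensingRate_stationary_of_abs_le hh hK,
    ENNReal.toReal_ofReal (div_nonneg (sensingFrequency_nonneg η) hh.le)]

theorem exists_orbitSum_threshold_le (U : ℕ → ℝ) (k d : ℕ) :
    ∃ K, ∀ m : ℕ, orbitSum (thresholdRule k) d U m
      ≤ cycleCost U (max k 1) / (max k 1 : ℕ) * m + K := by
  obtain ⟨k₀, hk₀⟩ := exists_iterate_thresholdRule_eq_one k d
  obtain ⟨K, hK⟩ := (isCycleLength_thresholdRule k).exists_abs_sum_sub_le hk₀ U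
  exact ⟨K, fun m => by have := (abs_le.mp (hK m)).2; rw [orbitSum]; linarith⟩

section Mixture

variable {Ω : Type} [MeasurableSpace Ω] {ℙ : Measure Ω} [IsProbabilityMeasure ℙ] {ϑ : Ω → Bool}

theorem lintegral_comp_bool (hϑ : Measurable ϑ) {q : ℝ} (hq0 : 0 ≤ q) (hq1 : q ≤ 1)
    (hq : ℙ {ω | ϑ ω = true} = ENNReal.ofReal q) {F : Bool → ℝ} (hF : ∀ t, 0 ≤ F t) :
    ∫⁻ ω, ENNReal.ofReal (F (ϑ ω)) ∂ℙ = ENNReal.ofReal (q * F true + (1 - q) * F false) := by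
  have htrue : ℙ.map ϑ {true} = ENNReal.ofReal q := by
    rw [Measure.map_apply hϑ (measurableSet_singleton _), ← hq]; rfl
  have hfalse : ℙ.map ϑ {false} = ENNReal.ofReal (1 - q) := by
    have hcompl : ϑ ⁻¹' {false} = {ω | ϑ ω = true}ᶜ := by ext ω; simp
    rw [Measure.map_apply hϑ (measurableSet_singleton _), hcompl,
      prob_compl_eq_one_sub (s := {ω | ϑ ω = true}) (hϑ (measurableSet_singleton true)), hq, ENNReal.ofReal_sub _ hq0,
      ENNReal.ofReal_one]
  rw [← lintegral_map (f := fun t => ENNReal.ofReal (F t)) measurable_from_top hϑ,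
    lintegral_fintype, Fintype.sum_bool, htrue, hfalse,
    ENNReal.ofReal_add (mul_nonneg hq0 (hF _)) (mul_nonneg (sub_nonneg.mpr hq1) (hF _)),
    ENNReal.ofReal_mul hq0, ENNReal.ofReal_mul (sub_nonneg.mpr hq1), mul_comm,
    mul_comm (b := ENNReal.ofReal (1 - q))]

variable (hϑ : Measurable ϑ) (η₁ η₂ : ℕ∞) (d : ℕ)

theorem age_mixedThreshold (ω : Ω) (k : ℕ) :
    (mixedThreshold ℙ ϑ hϑ η₁ η₂).age d ω k
      = (nextAge (thresholdRule (if ϑ ω then η₁ else η₂)))^[k] d := by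
  induction k with
  | zero => rfl
  | succ k ih => rw [Function.iterate_succ_apply', ← ih]; rfl

theorem action_mixedThreshold (ω : Ω) (k : ℕ) :
    (mixedThreshold ℙ ϑ hϑ η₁ η₂).action d ω k
      = ENNReal.ofReal (senseIndicator (thresholdRule (if ϑ ω then η₁ else η₂))
          ((nextAge (thresholdRule (if ϑ ω then η₁ else η₂)))^[k] d)) := by
  rw [← age_mixedThreshold (ℙ := ℙ) hϑ, senseIndicator]
  change (if thresholdRule (if ϑ ω then η₁ else η₂)
    ((mixedThreshold ℙ ϑ hϑ η₁ η₂).age d ω k) then (1 : ℝ≥0∞) else 0) = _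
  split_ifs <;> simp

variable {q : ℝ} (hq0 : 0 ≤ q) (hq1 : q ≤ 1) (hq : ℙ {ω | ϑ ω = true} = ENNReal.ofReal q)

include hq0 hq1 hq

theorem totalCost_mixedThreshold {U : ℕ → ℝ} (hU : ∀ j, 0 ≤ U j) (m : ℕ) :
    (mixedThreshold ℙ ϑ hϑ η₁ η₂).totalCost d U m
      = ENNReal.ofReal (q * orbitSum (thresholdRule η₁) d U (m + 1)
          + (1 - q) * orbitSum (thresholdRule η₂) d U (m + 1)) := by
  have := lintegral_comp_bool hϑ hq0 hq1 hq
    (F := fun t => orbitSum (thresholdRule (if t then η₁ else η₂)) d U (m + 1))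
    fun t => orbitSum_nonneg hU d _
  refine Eq.trans (lintegral_congr fun ω => ?_) (this.trans (by simp))
  rw [orbitSum, ENNReal.ofReal_sum_of_nonneg fun _ _ => hU _]
  exact Finset.sum_congr rfl fun k _ => congrArg (fun a => ENNReal.ofReal (U a))
    (age_mixedThreshold hϑ η₁ η₂ d ω k)

theorem totalSensings_mixedThreshold (m : ℕ) :
    (mixedThreshold ℙ ϑ hϑ η₁ η₂).totalSensings d m = ENNReal.ofReal
      (q * orbitSum (thresholdRule η₁) d (senseIndicator (thresholdRule η₁)) (m + 1)
        + (1 - q) * orbitSum (thresholdRule η₂) d (senseIndicator (thresholdRule η₂)) (m + 1)) := by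
  have := lintegral_comp_bool hϑ hq0 hq1 hq
    (F := fun t => orbitSum (thresholdRule (if t then η₁ else η₂)) d
      (senseIndicator (thresholdRule (if t then η₁ else η₂))) (m + 1))
    fun t => orbitSum_nonneg (senseIndicator_nonneg _) d _
  refine Eq.trans (lintegral_congr fun ω => ?_) (this.trans (by simp))
  rw [orbitSum, ENNReal.ofReal_sum_of_nonneg fun _ _ => senseIndicator_nonneg _ _]
  exact Finset.sum_congr rfl fun k _ => action_mixedThreshold hϑ η₁ η₂ d ω k

end Mixture

/-! ### The discounted problem -/

/-- The discounted Lagrangian cost `∑ β^k (U(a_k) + lam δ_k)` of an age sequence. -/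
noncomputable def discountedSum (U : ℕ → ℝ) (β : ℝ) (lam : ℝ≥0) (a : ℕ → ℕ) (δ : ℕ → Bool) :
    ℝ≥0∞ :=
  ∑' k : ℕ, ENNReal.ofReal (β ^ k * (U (a k) + lam * if δ k then 1 else 0))

theorem SensingPolicy.discountedCost_eq (μ : SensingPolicy) {U : ℕ → ℝ} (hU : ∀ j, 0 ≤ U j) {β : ℝ}
    (hβ : 0 ≤ β) (lam : ℝ≥0) (d : ℕ) :
    μ.discountedCost U β lam d = ∫⁻ ω, discountedSum U β lam (μ.age d ω)
      (fun k => μ.act ω (μ.history d ω k)) ∂μ.prob := by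
  refine lintegral_congr fun ω => tsum_congr fun k => ?_
  rw [μ.stageCost_eq_ofReal d hU, ENNReal.ofReal_mul (pow_nonneg hβ k)]

/-- Verification: a function `v` that satisfies the Bellman inequality along an age sequence, and
exceeds `U` by a bounded amount at most, is a lower bound on the discounted cost. No growth condition
on `U` is needed, since the excess of `v` over the cost already counted is bounded. -/
theorem ofReal_le_discountedSum {U : ℕ → ℝ} (hU : ∀ j, 0 ≤ U j) {β : ℝ} (hβ0 : 0 ≤ β)
    (hβ1 : β < 1) {lam : ℝ≥0} {a : ℕ → ℕ} {δ : ℕ → Bool} {v : ℕ → ℝ} {C : ℝ}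
    (hC : ∀ j, v j ≤ U j + C)
    (hv : ∀ k, v (a k) ≤ U (a k) + lam * (if δ k then 1 else 0) + β * v (a (k + 1))) :
    ENNReal.ofReal (v (a 0)) ≤ discountedSum U β lam a δ := by
  set c : ℕ → ℝ := fun k => U (a k) + lam * if δ k then 1 else 0 with hc
  have hc0 : ∀ k, 0 ≤ c k := fun k => add_nonneg (hU _) (by positivity)
  have partial_le : ∀ m : ℕ,
      v (a 0) ≤ ∑ k ∈ Finset.range m, β ^ k * c k + β ^ m * v (a m) := by
    intro m
    induction m with
    | zero => simp
    | succ m ih =>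
      have := mul_le_mul_of_nonneg_left (hv m) (pow_nonneg hβ0 m)
      rw [Finset.sum_range_succ, pow_succ]
      simp only [hc] at *
      linarith
  have bound : ∀ m : ℕ, ENNReal.ofReal (v (a 0) - β ^ m * C) ≤ discountedSum U β lam a δ := by
    intro m
    calc ENNReal.ofReal (v (a 0) - β ^ m * C)
        ≤ ENNReal.ofReal (∑ k ∈ Finset.range (m + 1), β ^ k * c k) := by
          refine ENNReal.ofReal_le_ofReal ?_
          have h1 : v (a m) ≤ c m + C := (hC _).trans (by
            simp only [hc]
            have : 0 ≤ (lam : ℝ) * if δ m then 1 else 0 := by positivity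
            linarith)
          have := mul_le_mul_of_nonneg_left h1 (pow_nonneg hβ0 m)
          rw [Finset.sum_range_succ]
          linarith [partial_le m]
      _ = ∑ k ∈ Finset.range (m + 1), ENNReal.ofReal (β ^ k * c k) :=
          ENNReal.ofReal_sum_of_nonneg fun k _ => mul_nonneg (pow_nonneg hβ0 k) (hc0 k)
      _ ≤ _ := ENNReal.sum_le_tsum _
  have hlim : Tendsto (fun m : ℕ => ENNReal.ofReal (v (a 0) - β ^ m * C)) atTop
      (𝓝 (ENNReal.ofReal (v (a 0) - 0 * C))) :=
    (ENNReal.continuous_ofReal.tendsto _).comp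
      (((tendsto_pow_atTop_nhds_zero_of_lt_one hβ0 hβ1).mul_const C).const_sub _)
  rw [zero_mul, sub_zero] at hlim
  exact le_of_tendsto' hlim bound

/-- The discounted cost of the rule `f` from the age `d`. -/
noncomputable def orbitDiscounted (U : ℕ → ℝ) (β : ℝ) (lam : ℝ≥0) (f : ℕ → Bool) (d : ℕ) : ℝ≥0∞ :=
  discountedSum U β lam (fun k => (nextAge f)^[k] d) fun k => f ((nextAge f)^[k] d)

theorem discountedCost_threshold {U : ℕ → ℝ} (hU : ∀ j, 0 ≤ U j) {β : ℝ} (hβ : 0 ≤ β)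
    (lam : ℝ≥0) (η : ℕ∞) (d : ℕ) :
    (threshold η).discountedCost U β lam d = orbitDiscounted U β lam (thresholdRule η) d := by
  rw [discountedCost_eq _ hU hβ]
  refine (lintegral_dirac (α := Unit) () _).trans ?_
  refine tsum_congr fun k => congrArg (fun a => ENNReal.ofReal
    (β ^ k * (U a + lam * if thresholdRule η a then 1 else 0)))
    (age_stationary d (thresholdRule η) () k)

theorem orbitDiscounted_eq {U : ℕ → ℝ} {β : ℝ} (hβ : 0 ≤ β) (lam : ℝ≥0)
    (f : ℕ → Bool) (d : ℕ) :
    orbitDiscounted U β lam f d = ENNReal.ofReal (U d + lam * if f d then 1 else 0)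
      + ENNReal.ofReal β * orbitDiscounted U β lam f (nextAge f d) := by
  rw [orbitDiscounted, discountedSum, tsum_eq_zero_add' ENNReal.summable, orbitDiscounted,
    discountedSum, ← ENNReal.tsum_mul_left]
  congr 1
  · rw [pow_zero, one_mul]; rfl
  · refine tsum_congr fun k => ?_
    rw [← ENNReal.ofReal_mul hβ, Function.iterate_succ_apply]
    congr 1
    ring

theorem iterate_thresholdRule_le (k d m : ℕ) :
    (nextAge (thresholdRule k))^[m] d ≤ max d k + 1 := by
  induction m with
  | zero => simp; omega
  | succ m ih =>
    rw [Function.iterate_succ_apply', nextAge]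
    split_ifs with h
    · omega
    · simp only [thresholdRule, Nat.cast_le, decide_eq_true_eq] at h
      omega

theorem orbitDiscounted_threshold_ne_top {U : ℕ → ℝ} (hU : Monotone U) {β : ℝ}
    (hβ0 : 0 ≤ β) (hβ1 : β < 1) (lam : ℝ≥0) (k d : ℕ) :
    orbitDiscounted U β lam (thresholdRule k) d ≠ ⊤ := by
  have hsum : Summable fun m : ℕ => β ^ m * (U (max d k + 1) + lam) :=
    (summable_geometric_of_lt_one hβ0 hβ1).mul_right _
  refine ne_top_of_le_ne_top hsum.tsum_ofReal_ne_top (ENNReal.tsum_le_tsum fun m => ?_)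
  refine ENNReal.ofReal_le_ofReal (mul_le_mul_of_nonneg_left (add_le_add
    (hU (iterate_thresholdRule_le k d m)) ?_) (pow_nonneg hβ0 m))
  split_ifs <;> simp

/-- The mean cost over a cycle of length `L` that is weighted by the discount factor `β`, the
sensing being charged `lam`. -/
noncomputable def discountedMean (U : ℕ → ℝ) (β lam : ℝ) (L : ℕ) : ℝ :=
  (∑ j ∈ Finset.range L, β ^ j * U (j + 1) + β ^ (L - 1) * lam) / ∑ j ∈ Finset.range L, β ^ j

theorem tendsto_discountedMean (U : ℕ → ℝ) (lam : ℝ) {L : ℕ} (hL : 0 < L) :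
    Tendsto (fun β => discountedMean U β lam L) (𝓝 1) (𝓝 ((cycleCost U L + lam) / L)) := by
  have hden : ∑ j ∈ Finset.range L, (1 : ℝ) ^ j ≠ 0 := by simpa using hL.ne'
  have hcont : ContinuousAt (fun β => discountedMean U β lam L) 1 := by
    unfold discountedMean
    exact ContinuousAt.div (by fun_prop) (by fun_prop) hden
  simpa [discountedMean, cycleCost] using hcont.tendsto

theorem thresholdRule_of_le {k a : ℕ} (h : k ≤ a) : thresholdRule k a = true := by
  simpa [thresholdRule] using h

theorem thresholdRule_of_lt {k a : ℕ} (h : a < k) : thresholdRule k a = false := by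
  simpa [thresholdRule] using h

/-- `v` is the value function of the threshold policy `k` in the discounted problem: it is the
(finite) cost, and satisfies the Bellman recursion of the policy. -/
structure IsThresholdValue (U : ℕ → ℝ) (β : ℝ) (lam : ℝ≥0) (k : ℕ) (v : ℕ → ℝ) : Prop where
  nonneg : ∀ a, 0 ≤ v a
  cost_eq : ∀ a, orbitDiscounted U β lam (thresholdRule k) a = ENNReal.ofReal (v a)
  eq_of_lt : ∀ a, a < k → v a = U a + β * v (a + 1)
  eq_of_le : ∀ a, k ≤ a → v a = U a + lam + β * v 1

theorem exists_isThresholdValue {U : ℕ → ℝ} (hU : ∀ j, 0 ≤ U j) (hmono : Monotone U) {β : ℝ}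
    (hβ0 : 0 ≤ β) (hβ1 : β < 1) (lam : ℝ≥0) (k : ℕ) :
    ∃ v, IsThresholdValue U β lam k v := by
  have hfin := orbitDiscounted_threshold_ne_top hmono hβ0 hβ1 lam k
  have hrec : ∀ a, (orbitDiscounted U β lam (thresholdRule k) a).toReal
      = (U a + lam * if thresholdRule k a then 1 else 0)
        + β * (orbitDiscounted U β lam (thresholdRule k) (nextAge (thresholdRule k) a)).toReal := by
    intro a
    rw [orbitDiscounted_eq hβ0, ENNReal.toReal_add ENNReal.ofReal_ne_top
      (ENNReal.mul_ne_top ENNReal.ofReal_ne_top (hfin _)), ENNReal.toReal_mul,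
      ENNReal.toReal_ofReal hβ0, ENNReal.toReal_ofReal (add_nonneg (hU a) (by positivity))]
  refine ⟨fun a => (orbitDiscounted U β lam (thresholdRule k) a).toReal,
    fun a => ENNReal.toReal_nonneg, fun a => (ENNReal.ofReal_toReal (hfin a)).symm,
    fun a ha => ?_, fun a ha => ?_⟩
  · have := hrec a
    rw [nextAge_of_false (thresholdRule_of_lt ha), thresholdRule_of_lt ha] at this
    simpa using this
  · have := hrec a
    rw [nextAge_of_true (thresholdRule_of_le ha), thresholdRule_of_le ha] at this
    simpa using this

namespace IsThresholdValue

variable {U : ℕ → ℝ} {β : ℝ} {lam : ℝ≥0} {k : ℕ} {v : ℕ → ℝ}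

theorem one_sub_mul (hv : IsThresholdValue U β lam k v) (hβ0 : 0 < β) :
    (1 - β) * v 1 = discountedMean U β lam (max k 1) := by
  obtain ⟨l, hl⟩ : ∃ l, max k 1 = l + 1 := ⟨max k 1 - 1, by omega⟩
  have hwait : ∀ i ≤ l, v 1 = ∑ j ∈ Finset.range i, β ^ j * U (j + 1) + β ^ i * v (i + 1) := by
    intro i hi
    induction i with
    | zero => simp
    | succ i ih =>
      rw [ih (by omega), Finset.sum_range_succ, hv.eq_of_lt (i + 1) (by omega), pow_succ]
      ring
  have hcycle := hwait l le_rfl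
  rw [hv.eq_of_le (l + 1) (by omega)] at hcycle
  have hden : 0 < ∑ j ∈ Finset.range (l + 1), β ^ j :=
    Finset.sum_pos (fun j _ => pow_pos hβ0 j) ⟨0, by simp⟩
  rw [discountedMean, hl, eq_div_iff hden.ne', Nat.add_sub_cancel]
  have hgeom := mul_neg_geom_sum β (l + 1)
  calc (1 - β) * v 1 * ∑ j ∈ Finset.range (l + 1), β ^ j
      = v 1 * (1 - β ^ (l + 1)) := by rw [← hgeom]; ring
    _ = _ := by rw [Finset.sum_range_succ]; linear_combination hcycle

theorem exists_le_add (hv : IsThresholdValue U β lam k v) (hβ0 : 0 ≤ β) (hβ1 : β < 1) :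
    ∃ C, ∀ j, v j ≤ U j + C := by
  have hsum : ∀ i ≤ k, v i ≤ ∑ i ∈ Finset.range (k + 1), v i := fun i hi =>
    Finset.single_le_sum (fun i _ => hv.nonneg i) (Finset.mem_range.mpr (by omega))
  have hsum0 : 0 ≤ ∑ i ∈ Finset.range (k + 1), v i := Finset.sum_nonneg fun i _ => hv.nonneg i
  have hc : 0 ≤ lam + β * v 1 := add_nonneg lam.2 (mul_nonneg hβ0 (hv.nonneg 1))
  refine ⟨lam + β * v 1 + ∑ i ∈ Finset.range (k + 1), v i, fun j => ?_⟩
  rcases lt_or_ge j k with h | h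
  · rw [hv.eq_of_lt j h]
    have := mul_le_of_le_one_left (hv.nonneg (j + 1)) hβ1.le
    linarith [hsum (j + 1) h]
  · rw [hv.eq_of_le j h]
    linarith

end IsThresholdValue

theorem isDiscountOptimalThreshold_of_bellman {U : ℕ → ℝ} (hU : ∀ j, 0 ≤ U j) {β : ℝ}
    (hβ0 : 0 ≤ β) (hβ1 : β < 1) {lam : ℝ≥0} {η : ℕ∞} {v : ℕ → ℝ} {C : ℝ}
    (hcost : ∀ a, orbitDiscounted U β lam (thresholdRule η) a = ENNReal.ofReal (v a))
    (hC : ∀ j, v j ≤ U j + C) (hwait : ∀ a, v a ≤ U a + β * v (a + 1))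
    (hsense : ∀ a, v a ≤ U a + lam + β * v 1) :
    IsDiscountOptimalThreshold U β lam η := by
  intro d
  refine le_antisymm (le_iInf fun μ => ?_) (iInf_le _ _)
  rw [discountedCost_threshold hU hβ0, hcost, μ.discountedCost_eq hU hβ0]
  calc ENNReal.ofReal (v d) = ∫⁻ _, ENNReal.ofReal (v d) ∂μ.prob := by simp
    _ ≤ _ := lintegral_mono fun ω => ?_
  refine ofReal_le_discountedSum (a := μ.age d ω) hU hβ0 hβ1 hC fun k => ?_
  have hstep := μ.isAgePath d ω k
  cases hδ : μ.act ω (μ.history d ω k)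
  · simp only [hδ] at hstep
    rw [hstep]
    simpa using hwait (μ.age d ω k)
  · simp only [hδ] at hstep
    rw [hstep]
    simpa using hsense (μ.age d ω k)

/-- A threshold `k ≥ 1` is `β`-optimal if the mean cost of its policy lies between the costs of the
ages `k` and `k + 1`, up to discounting: sensing then pays from age `k` on, and not before. -/
theorem isDiscountOptimalThreshold_natCast {U : ℕ → ℝ} (hU : ∀ j, 0 ≤ U j) (hmono : Monotone U)
    {β : ℝ} (hβ0 : 0 < β) (hβ1 : β < 1) {lam : ℝ≥0} {k : ℕ} (hk : 0 < k)
    (hlow : β * U k ≤ (1 - β) * lam + β * discountedMean U β lam k)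
    (hupp : (1 - β) * lam + β * discountedMean U β lam k ≤ β * U (k + 1)) :
    IsDiscountOptimalThreshold U β lam k := by
  obtain ⟨v, hv⟩ := exists_isThresholdValue hU hmono hβ0.le hβ1 lam k
  obtain ⟨C, hC⟩ := hv.exists_le_add hβ0.le hβ1
  have hmean := hv.one_sub_mul hβ0
  rw [max_eq_left (Nat.succ_le_of_lt hk)] at hmean
  rw [← hmean] at hlow hupp
  have hreset : ∀ i j, j + i = k → β * v j ≤ lam + β * v 1 := by
    intro i
    induction i with
    | zero =>
      intro j hj
      rw [hv.eq_of_le j (by omega), show j = k by omega]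
      linarith
    | succ i ih =>
      intro j hj
      rw [hv.eq_of_lt j (by omega)]
      have h1 := mul_le_mul_of_nonneg_left (ih (j + 1) (by omega)) hβ0.le
      have h2 := mul_le_mul_of_nonneg_left (hmono (show j ≤ k by omega)) hβ0.le
      linarith
  refine isDiscountOptimalThreshold_of_bellman hU hβ0.le hβ1 hv.cost_eq hC (fun a => ?_)
    fun a => ?_
  · rcases lt_or_ge a k with h | h
    · exact (hv.eq_of_lt a h).le
    · rw [hv.eq_of_le a h, hv.eq_of_le (a + 1) (by omega)]
      have := mul_le_mul_of_nonneg_left (hmono (show k + 1 ≤ a + 1 by omega)) hβ0.le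
      linarith
  · rcases lt_or_ge a k with h | h
    · rw [hv.eq_of_lt a h]
      linarith [hreset (k - (a + 1)) (a + 1) (by omega)]
    · exact (hv.eq_of_le a h).le

/-- Never sensing is optimal at every discount factor if the total cost that a sensing can ever save
is at most its charge. -/
theorem isDiscountOptimalThreshold_top {U : ℕ → ℝ} (hU : ∀ j, 0 ≤ U j) (hmono : Monotone U)
    {β : ℝ} (hβ0 : 0 ≤ β) (hβ1 : β < 1) {lam : ℝ≥0} {u : ℝ} (hu : ∀ j, U j ≤ u)
    (hloss : ∀ n : ℕ, ∑ i ∈ Finset.range n, (u - U (i + 1)) ≤ lam) :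
    IsDiscountOptimalThreshold U β lam ⊤ := by
  have hsummable : ∀ a, Summable fun k : ℕ => β ^ k * U (a + k) := fun a =>
    Summable.of_nonneg_of_le (fun k => mul_nonneg (pow_nonneg hβ0 k) (hU _))
      (fun k => mul_le_mul_of_nonneg_left (hu _) (pow_nonneg hβ0 k))
      ((summable_geometric_of_lt_one hβ0 hβ1).mul_right u)
  set v : ℕ → ℝ := fun a => ∑' k : ℕ, β ^ k * U (a + k) with hvdef
  have hrec : ∀ a, v a = U a + β * v (a + 1) := by
    intro a
    simp only [hvdef]
    rw [(hsummable a).tsum_eq_zero_add, ← tsum_mul_left]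
    congr 1
    · simp
    · refine tsum_congr fun k => ?_
      rw [show a + (k + 1) = a + 1 + k by ring]
      ring
  have hdiff : ∀ a, v (a + 1) - v 1 ≤ lam := by
    intro a
    simp only [hvdef]
    rw [← (hsummable (a + 1)).tsum_sub (hsummable 1)]
    refine Real.tsum_le_of_sum_range_le (fun k => ?_) fun n => ?_
    · rw [← mul_sub]
      exact mul_nonneg (pow_nonneg hβ0 k) (sub_nonneg.mpr (hmono (by omega)))
    · refine (Finset.sum_le_sum fun k _ => ?_).trans (hloss n)
      rw [← mul_sub, add_comm 1 k]
      refine (mul_le_of_le_one_left (sub_nonneg.mpr (hmono (by omega)))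
        (pow_le_one₀ hβ0 hβ1.le)).trans ?_
      linarith [hu (a + 1 + k)]
  have hv1 : 0 ≤ v 1 := tsum_nonneg fun k => mul_nonneg (pow_nonneg hβ0 k) (hU _)
  have hsense : ∀ a, v a ≤ U a + lam + β * v 1 := by
    intro a
    rw [hrec a]
    have := mul_le_mul_of_nonneg_left (hdiff a) hβ0
    have := mul_le_of_le_one_left lam.coe_nonneg hβ1.le
    linarith
  refine isDiscountOptimalThreshold_of_bellman (C := lam + β * v 1) hU hβ0 hβ1 (fun a => ?_)
    (fun a => by linarith [hsense a]) (fun a => (hrec a).le) hsense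
  rw [orbitDiscounted, discountedSum, hvdef,
    ENNReal.ofReal_tsum_of_nonneg (fun k => mul_nonneg (pow_nonneg hβ0 k) (hU _)) (hsummable a)]
  refine tsum_congr fun k => ?_
  rw [iterate_nextAge_of_forall_false fun i => thresholdRule_top (a + i)]
  simp [thresholdRule_top]

/-! ### Limits of discount-optimal thresholds -/

theorem isLimitThreshold_of_eventually {U : ℕ → ℝ} {lam : ℝ≥0} {η : ℕ∞}
    (h : ∀ᶠ β in 𝓝[<] (1 : ℝ), IsDiscountOptimalThreshold U β lam η) :
    IsLimitThreshold U lam η := by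
  have hpos : ∀ᶠ β in 𝓝[<] (1 : ℝ), 0 < β ∧ β < 1 := by
    filter_upwards [Ioo_mem_nhdsLT (zero_lt_one' ℝ)] with β hβ using hβ
  obtain ⟨β, hβ, hall⟩ := exists_seq_forall_of_frequently (hpos.and h).frequently
  exact ⟨β, fun _ => η, fun l => (hall l).1, hβ.mono_right nhdsWithin_le_nhds,
    fun l => (hall l).2, tendsto_const_nhds⟩

/-- If the mean Lagrangian cost of cycles of length `k` lies *strictly* between `U(k)` and
`U(k + 1)`, the discounted optimality conditions hold for all discount factors close to `1`. -/
theorem isLimitThreshold_natCast {U : ℕ → ℝ} (hU : ∀ j, 0 ≤ U j) (hmono : Monotone U)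
    {lam : ℝ≥0} {k : ℕ} (hk : 0 < k) (hlow : U k < (cycleCost U k + lam) / k)
    (hupp : (cycleCost U k + lam) / k < U (k + 1)) : IsLimitThreshold U lam k := by
  refine isLimitThreshold_of_eventually ?_
  have hmid : Tendsto (fun β : ℝ => (1 - β) * lam + β * discountedMean U β lam k) (𝓝[<] 1)
      (𝓝 ((1 - 1) * lam + 1 * ((cycleCost U k + lam) / k))) := by
    refine Tendsto.mono_left ?_ nhdsWithin_le_nhds
    exact ((tendsto_const_nhds.sub tendsto_id).mul_const _).add
      (tendsto_id.mul (tendsto_discountedMean U lam hk))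
  have hside : ∀ x : ℝ, Tendsto (fun β : ℝ => β * x) (𝓝[<] 1) (𝓝 (1 * x)) := fun x =>
    (tendsto_id.mul_const x).mono_left nhdsWithin_le_nhds
  filter_upwards [Ioo_mem_nhdsLT (zero_lt_one' ℝ),
    (hside (U k)).eventually_lt hmid (by linarith),
    hmid.eventually_lt (hside (U (k + 1))) (by linarith)] with β hβ h1 h2
  exact isDiscountOptimalThreshold_natCast hU hmono hβ.1 hβ.2 hk h1.le h2.le

/-- At zero charge, sensing at every step is optimal. -/
theorem isLimitThreshold_zero_one {U : ℕ → ℝ} (hU : ∀ j, 0 ≤ U j) (hmono : Monotone U) :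
    IsLimitThreshold U 0 (1 : ℕ) := by
  refine isLimitThreshold_of_eventually ?_
  filter_upwards [Ioo_mem_nhdsLT (zero_lt_one' ℝ)] with β hβ
  refine isDiscountOptimalThreshold_natCast hU hmono hβ.1 hβ.2 one_pos ?_ ?_
  · simp [discountedMean]
  · simpa [discountedMean] using mul_le_mul_of_nonneg_left (hmono one_le_two) hβ.1.le

theorem discountedMean_le_of_optimal {U : ℕ → ℝ} (hU : ∀ j, 0 ≤ U j) (hmono : Monotone U)
    {β : ℝ} (hβ0 : 0 < β) (hβ1 : β < 1) {lam : ℝ≥0} {k : ℕ}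
    (hopt : IsDiscountOptimalThreshold U β lam k) {L : ℕ} (hL : 0 < L) :
    discountedMean U β lam (max k 1) ≤ discountedMean U β lam L := by
  obtain ⟨v, hv⟩ := exists_isThresholdValue hU hmono hβ0.le hβ1 lam k
  obtain ⟨w, hw⟩ := exists_isThresholdValue hU hmono hβ0.le hβ1 lam L
  have hle : (threshold k).discountedCost U β lam 1 ≤ (threshold L).discountedCost U β lam 1 :=
    (hopt 1).le.trans (iInf_le _ _)
  rw [discountedCost_threshold hU hβ0.le, discountedCost_threshold hU hβ0.le, hv.cost_eq,
    hw.cost_eq, ENNReal.ofReal_le_ofReal_iff (hw.nonneg 1)] at hle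
  have hw1 := hw.one_sub_mul hβ0
  rw [max_eq_left (Nat.succ_le_of_lt hL)] at hw1
  rw [← hv.one_sub_mul hβ0, ← hw1]
  exact mul_le_mul_of_nonneg_left hle (by linarith)

/-- A policy that waits at least until the age `M` pays at least the discounted mean of
`U(1), …, U(M)`. -/
theorem discountedMean_zero_le_of_optimal {U : ℕ → ℝ} (hU : ∀ j, 0 ≤ U j) (hmono : Monotone U)
    {β : ℝ} (hβ0 : 0 < β) (hβ1 : β < 1) {lam : ℝ≥0} {η : ℕ∞}
    (hopt : IsDiscountOptimalThreshold U β lam η) {L M : ℕ} (hL : 0 < L) (hM : 0 < M)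
    (hMη : (M : ℕ∞) ≤ η) :
    discountedMean U β 0 M ≤ discountedMean U β lam L := by
  -- `v` is the value of threshold `M` without a charge; it is a subsolution for later thresholds.
  obtain ⟨v, hv⟩ := exists_isThresholdValue hU hmono hβ0.le hβ1 0 M
  obtain ⟨C, hC⟩ := hv.exists_le_add hβ0.le hβ1
  obtain ⟨w, hw⟩ := exists_isThresholdValue hU hmono hβ0.le hβ1 lam L
  have hv1 := hv.one_sub_mul hβ0
  rw [max_eq_left (Nat.succ_le_of_lt hM)] at hv1
  have hmean : discountedMean U β ((0 : ℝ≥0) : ℝ) M ≤ U M := by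
    rw [discountedMean, div_le_iff₀ (Finset.sum_pos (fun j _ => pow_pos hβ0 j) ⟨0, by simpa⟩),
      NNReal.coe_zero, mul_zero, add_zero, Finset.mul_sum]
    refine Finset.sum_le_sum fun j hj => ?_
    rw [mul_comm]
    exact mul_le_mul_of_nonneg_right (hmono (Nat.succ_le_of_lt (Finset.mem_range.mp hj)))
      (pow_nonneg hβ0.le j)
  have hle : ENNReal.ofReal (v 1) ≤ ENNReal.ofReal (w 1) := by
    rw [← hw.cost_eq, ← discountedCost_threshold hU hβ0.le]
    refine le_trans ?_ ((hopt 1).le.trans (iInf_le _ _))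
    rw [discountedCost_threshold hU hβ0.le]
    refine ofReal_le_discountedSum (a := fun k => (nextAge (thresholdRule η))^[k] 1) hU hβ0.le hβ1
      hC fun k => ?_
    simp only [Function.iterate_succ_apply']
    generalize (nextAge (thresholdRule η))^[k] 1 = a
    have hwait : v a ≤ U a + β * v (a + 1) := by
      rcases lt_or_ge a M with h | h
      · exact (hv.eq_of_lt a h).le
      · rw [hv.eq_of_le a h, hv.eq_of_le (a + 1) (by omega), NNReal.coe_zero, add_zero, add_zero]
        have h1 := hmono (show M ≤ a + 1 by omega)
        have h2 := mul_le_mul_of_nonneg_left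
          (show v 1 ≤ U (a + 1) + β * v 1 by linarith) hβ0.le
        linarith
    cases hδ : thresholdRule η a
    · rw [nextAge_of_false hδ]
      simpa using hwait
    · rw [nextAge_of_true hδ]
      have hMa : M ≤ a := by
        simp only [thresholdRule, decide_eq_true_eq] at hδ
        exact_mod_cast hMη.trans hδ
      have := hv.eq_of_le a hMa
      simp only [NNReal.coe_zero, add_zero] at this
      simp [this]
  rw [ENNReal.ofReal_le_ofReal_iff (hw.nonneg 1)] at hle
  have hw1 := hw.one_sub_mul hβ0
  rw [max_eq_left (Nat.succ_le_of_lt hL)] at hw1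
  rw [← hw1, ← NNReal.coe_zero, ← hv1]
  exact mul_le_mul_of_nonneg_left hle (by linarith)

theorem IsLimitThreshold.mean_le {U : ℕ → ℝ} (hU : ∀ j, 0 ≤ U j) (hmono : Monotone U)
    {lam : ℝ≥0} {k : ℕ} (h : IsLimitThreshold U lam k) {L : ℕ} (hL : 0 < L) :
    (cycleCost U (max k 1) + lam) / (max k 1 : ℕ) ≤ (cycleCost U L + lam) / L := by
  obtain ⟨β, θ, hβ, hlim, hopt, hθ⟩ := h
  refine le_of_tendsto_of_tendsto ((tendsto_discountedMean U lam (by omega)).comp hlim)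
    ((tendsto_discountedMean U lam hL).comp hlim) ?_
  rw [ENat.nhds_natCast, tendsto_pure] at hθ
  filter_upwards [hθ] with l hl
  exact discountedMean_le_of_optimal hU hmono (hβ l).1 (hβ l).2 (hl ▸ hopt l) hL

theorem IsLimitThreshold.mean_le_of_top {U : ℕ → ℝ} (hU : ∀ j, 0 ≤ U j) (hmono : Monotone U)
    {lam : ℝ≥0} (h : IsLimitThreshold U lam ⊤) {L M : ℕ} (hL : 0 < L) (hM : 0 < M) :
    cycleCost U M / M ≤ (cycleCost U L + lam) / L := by
  obtain ⟨β, θ, hβ, hlim, hopt, hθ⟩ := h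
  have h0 := tendsto_discountedMean U 0 hM
  rw [add_zero] at h0
  refine le_of_tendsto_of_tendsto (h0.comp hlim) ((tendsto_discountedMean U lam hL).comp hlim) ?_
  filter_upwards [ENat.tendsto_nhds_top_iff_natCast_lt.mp hθ M] with l hl
  exact discountedMean_zero_le_of_optimal hU hmono (hβ l).1 (hβ l).2 (hopt l) hL hM hl.le

/-! ### Optimal cycle lengths -/

/-- The charge per sensing at which cycles of the lengths `M` and `M + 1` are equally good. -/
noncomputable def switchCharge (U : ℕ → ℝ) (M : ℕ) : ℝ := M * U (M + 1) - cycleCost U M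

@[simp] theorem switchCharge_zero (U : ℕ → ℝ) : switchCharge U 0 = 0 := by simp [switchCharge]

theorem switchCharge_mono {U : ℕ → ℝ} (hmono : Monotone U) : Monotone (switchCharge U) := by
  refine monotone_nat_of_le_succ fun M => ?_
  have h1 : switchCharge U (M + 1) = switchCharge U M + (M + 1) * (U (M + 2) - U (M + 1)) := by
    simp only [switchCharge, cycleCost_succ]; push_cast; ring
  rw [h1]
  exact le_add_of_nonneg_right
    (mul_nonneg (by positivity) (sub_nonneg.mpr (hmono (by omega))))

theorem switchCharge_nonneg {U : ℕ → ℝ} (hmono : Monotone U) (M : ℕ) : 0 ≤ switchCharge U M := by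
  simpa using switchCharge_mono hmono (Nat.zero_le M)

/-- The values of a monotone sequence do not accumulate at any of them. -/
theorem exists_gap {T : ℕ → ℝ} (hT : Monotone T) (N : ℕ) :
    ∃ ε : ℝ, 0 < ε ∧ ∀ M, T N < T M + ε → T M < T N + ε → T M = T N := by
  have hbelow : ∃ ε : ℝ, 0 < ε ∧ ∀ M, T N < T M + ε → T N ≤ T M := by
    by_cases h : ∃ M, T M < T N
    · have hlt : ∀ M, T M < T N → M < N := fun M hM => not_le.mp fun hle => (hT hle).not_gt hM
      classical
      obtain ⟨M₀, hM₀⟩ := h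
      set s := (Finset.range N).filter fun M => T M < T N
      have hs : s.Nonempty := ⟨M₀, by simp [s, hlt M₀ hM₀, hM₀]⟩
      obtain ⟨j, hj, hmax⟩ := s.exists_max_image T hs
      refine ⟨T N - T j, sub_pos.mpr (Finset.mem_filter.mp hj).2, fun M hM => ?_⟩
      by_contra hcon
      rw [not_le] at hcon
      have := hmax M (by simp [s, hlt M hcon, hcon])
      linarith
    · push Not at h
      exact ⟨1, one_pos, fun M _ => h M⟩
  have habove : ∃ ε : ℝ, 0 < ε ∧ ∀ M, T M < T N + ε → T M ≤ T N := by
    classical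
    by_cases h : ∃ M, T N < T M
    · refine ⟨T (Nat.find h) - T N, sub_pos.mpr (Nat.find_spec h), fun M hM => ?_⟩
      by_contra hcon
      have := hT (Nat.find_min' h (not_le.mp hcon))
      linarith
    · push Not at h
      exact ⟨1, one_pos, fun M _ => h M⟩
  obtain ⟨ε₁, h₁, hb⟩ := hbelow
  obtain ⟨ε₂, h₂, ha⟩ := habove
  exact ⟨min ε₁ ε₂, lt_min h₁ h₂, fun M h h' => le_antisymm
    (ha M (h'.trans_le (by gcongr; exact min_le_right _ _)))
    (hb M (h.trans_le (by gcongr; exact min_le_left _ _)))⟩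

/-- The mean Lagrangian cost per step over a cycle of length `L`. -/
noncomputable def cycleMean (U : ℕ → ℝ) (lam : ℝ) (L : ℕ) : ℝ := (cycleCost U L + lam) / L

/-- The cycle length `N` minimizes the mean Lagrangian cost; this is stated through its neighbours,
see `IsOptimalLength.cycleMean_mul_le`. -/
structure IsOptimalLength (U : ℕ → ℝ) (lam : ℝ) (N : ℕ) : Prop where
  pos : 0 < N
  low : switchCharge U (N - 1) ≤ lam
  upp : lam ≤ switchCharge U N

theorem mul_cycleMean_sub {U : ℕ → ℝ} {lam : ℝ} {N : ℕ} (hN : 0 < N) :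
    N * (cycleMean U lam N - U N) = lam - switchCharge U (N - 1) := by
  obtain ⟨n, rfl⟩ := Nat.exists_eq_add_of_le' hN
  rw [cycleMean, switchCharge, Nat.add_sub_cancel, cycleCost_succ, mul_sub,
    mul_div_cancel₀ _ (by positivity)]
  push_cast
  ring

theorem mul_sub_cycleMean {U : ℕ → ℝ} {lam : ℝ} {N : ℕ} (hN : 0 < N) :
    N * (U (N + 1) - cycleMean U lam N) = switchCharge U N - lam := by
  have : (N : ℝ) ≠ 0 := by exact_mod_cast hN.ne'
  rw [cycleMean, switchCharge, mul_sub, mul_div_cancel₀ _ this]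
  ring

theorem le_cycleMean_iff {U : ℕ → ℝ} {lam : ℝ} {N : ℕ} (hN : 0 < N) :
    U N ≤ cycleMean U lam N ↔ switchCharge U (N - 1) ≤ lam := by
  have : (0 : ℝ) < N := by exact_mod_cast hN
  rw [← sub_nonneg, ← sub_nonneg (b := switchCharge U (N - 1)), ← mul_cycleMean_sub hN,
    mul_nonneg_iff_of_pos_left this]

theorem lt_cycleMean_iff {U : ℕ → ℝ} {lam : ℝ} {N : ℕ} (hN : 0 < N) :
    U N < cycleMean U lam N ↔ switchCharge U (N - 1) < lam := by
  have : (0 : ℝ) < N := by exact_mod_cast hN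
  rw [← sub_pos, ← sub_pos (b := switchCharge U (N - 1)), ← mul_cycleMean_sub hN,
    mul_pos_iff_of_pos_left this]

theorem cycleMean_le_iff {U : ℕ → ℝ} {lam : ℝ} {N : ℕ} (hN : 0 < N) :
    cycleMean U lam N ≤ U (N + 1) ↔ lam ≤ switchCharge U N := by
  have : (0 : ℝ) < N := by exact_mod_cast hN
  rw [← sub_nonneg, ← sub_nonneg (b := lam), ← mul_sub_cycleMean hN,
    mul_nonneg_iff_of_pos_left this]

theorem cycleMean_lt_iff {U : ℕ → ℝ} {lam : ℝ} {N : ℕ} (hN : 0 < N) :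
    cycleMean U lam N < U (N + 1) ↔ lam < switchCharge U N := by
  have : (0 : ℝ) < N := by exact_mod_cast hN
  rw [← sub_pos, ← sub_pos (b := lam), ← mul_sub_cycleMean hN, mul_pos_iff_of_pos_left this]

namespace IsOptimalLength

variable {U : ℕ → ℝ} {lam : ℝ} {N : ℕ}

theorem cycleMean_mul_le (h : IsOptimalLength U lam N) (hmono : Monotone U) (L : ℕ) :
    cycleMean U lam N * L ≤ cycleCost U L + lam := by
  have hlow := (le_cycleMean_iff h.pos).mpr h.low
  have hupp := (cycleMean_le_iff h.pos).mpr h.upp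
  have hN : cycleMean U lam N * N = cycleCost U N + lam := by
    have : (N : ℝ) ≠ 0 := by exact_mod_cast h.pos.ne'
    rw [cycleMean]
    field_simp
  set g := cycleMean U lam N
  rcases le_total N L with hL | hL
  · induction L, hL using Nat.le_induction with
    | base => exact hN.le
    | succ L hL ih =>
      rw [cycleCost_succ]
      push_cast
      linarith [hmono (show N + 1 ≤ L + 1 by omega)]
  · induction hL using Nat.decreasingInduction with
    | of_succ L hL ih =>
      rw [cycleCost_succ] at ih
      push_cast at ih
      linarith [hmono (show L + 1 ≤ N by omega)]
    | self => exact hN.le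

theorem cycleMean_eq {N' : ℕ} (h : IsOptimalLength U lam N) (h' : IsOptimalLength U lam N')
    (hmono : Monotone U) : cycleMean U lam N = cycleMean U lam N' := by
  have hN : (0 : ℝ) < N := by exact_mod_cast h.pos
  have hN' : (0 : ℝ) < N' := by exact_mod_cast h'.pos
  apply le_antisymm
  · rw [cycleMean.eq_def U lam N', le_div_iff₀ hN']
    exact h.cycleMean_mul_le hmono N'
  · rw [cycleMean.eq_def U lam N, le_div_iff₀ hN]
    exact h'.cycleMean_mul_le hmono N

theorem cycleMean_nonneg (h : IsOptimalLength U lam N) (hU : ∀ j, 0 ≤ U j) :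
    0 ≤ cycleMean U lam N :=
  (hU N).trans ((le_cycleMean_iff h.pos).mpr h.low)

/-- If no cycle length is too long at the charge `lam`, the age costs never exceed the optimal
mean. -/
theorem le_cycleMean_of_forall_le (h : IsOptimalLength U lam N) (hmono : Monotone U)
    (hall : ∀ M, switchCharge U M ≤ lam) (j : ℕ) : U j ≤ cycleMean U lam N := by
  have hM : IsOptimalLength U lam (max j N + 1) :=
    ⟨by omega, hall _, h.upp.trans (switchCharge_mono hmono (by omega))⟩
  rw [h.cycleMean_eq hM hmono]
  exact (hmono (by omega)).trans ((le_cycleMean_iff hM.pos).mpr hM.low)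

end IsOptimalLength

theorem isOptimalLength_switchCharge {U : ℕ → ℝ} (hmono : Monotone U) {N : ℕ} (hN : 0 < N) :
    IsOptimalLength U (switchCharge U N) N :=
  ⟨hN, switchCharge_mono hmono (by omega), le_rfl⟩

theorem isOptimalLength_switchCharge_succ {U : ℕ → ℝ} (hmono : Monotone U) (N : ℕ) :
    IsOptimalLength U (switchCharge U N) (N + 1) :=
  ⟨N.succ_pos, le_rfl, switchCharge_mono hmono (by omega)⟩

theorem IsLimitThreshold.isOptimalLength {U : ℕ → ℝ} (hU : ∀ j, 0 ≤ U j) (hmono : Monotone U)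
    {lam : ℝ≥0} {k : ℕ} (h : IsLimitThreshold U lam k) : IsOptimalLength U lam (max k 1) := by
  have hle := fun L (hL : 0 < L) => h.mean_le hU hmono hL
  obtain ⟨n, hn⟩ : ∃ n, max k 1 = n + 1 := ⟨max k 1 - 1, by omega⟩
  rw [hn] at hle ⊢
  refine ⟨n.succ_pos, ?_, ?_⟩
  · rcases Nat.eq_zero_or_pos n with rfl | hpos
    · simp
    · have hn0 : (0 : ℝ) < n := by exact_mod_cast hpos
      have := hle n hpos
      rw [div_le_div_iff₀ (by positivity) hn0, cycleCost_succ] at this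
      rw [Nat.add_sub_cancel, switchCharge]
      push_cast at this
      linarith
  · have := hle (n + 2) (by omega)
    rw [div_le_div_iff₀ (by positivity) (by positivity), cycleCost_succ U (n + 1)] at this
    rw [switchCharge]
    push_cast at this ⊢
    linarith

theorem IsLimitThreshold.switchCharge_le {U : ℕ → ℝ} (hU : ∀ j, 0 ≤ U j) (hmono : Monotone U)
    {lam : ℝ≥0} (h : IsLimitThreshold U lam ⊤) (M : ℕ) : switchCharge U M ≤ lam := by
  rcases Nat.eq_zero_or_pos M with rfl | hM
  · simp
  have hM0 : (0 : ℝ) < M := by exact_mod_cast hM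
  by_contra hcon
  have hlt : cycleMean U lam M < U (M + 1) := by
    rw [cycleMean, div_lt_iff₀ hM0]
    rw [switchCharge] at hcon
    linarith
  set g := cycleMean U lam M with hg
  have hgrow : ∀ j : ℕ, j * U (M + 1) ≤ cycleCost U (M + j) := by
    intro j
    induction j with
    | zero => simpa [cycleCost] using Finset.sum_nonneg fun i _ => hU (i + 1)
    | succ j ih =>
      rw [← add_assoc, cycleCost_succ]
      push_cast
      linarith [hmono (show M + 1 ≤ M + j + 1 by omega)]
  -- The means over longer and longer cycles approach the supremum of the age costs.
  obtain ⟨j, hj⟩ := exists_nat_gt (g * M / (U (M + 1) - g))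
  rw [div_lt_iff₀ (sub_pos.mpr hlt)] at hj
  have hmean := h.mean_le_of_top hU hmono hM (M := M + j) (by omega)
  rw [← cycleMean, ← hg, div_le_iff₀ (by positivity)] at hmean
  push_cast at hmean
  linarith [hgrow j]

/-! ### Policies that attain the dual bound -/

/-- The age costs under the threshold `η` grow at most at the rate `g - lam r`, where `r` is its
sensing frequency: its Lagrangian cost per step is at most `g`. -/
def AttainsGain (U : ℕ → ℝ) (d : ℕ) (lam g : ℝ) (η : ℕ∞) : Prop :=
  ∃ K, ∀ m : ℕ, orbitSum (thresholdRule η) d U m ≤ (g - lam * sensingFrequency η) * m + K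

theorem attainsGain_natCast (U : ℕ → ℝ) (d : ℕ) (lam : ℝ) (k : ℕ) :
    AttainsGain U d lam (cycleMean U lam (max k 1)) k := by
  obtain ⟨K, hK⟩ := exists_orbitSum_threshold_le U k d
  refine ⟨K, fun m => (hK m).trans (le_of_eq ?_)⟩
  rw [cycleMean, sensingFrequency_coe]
  ring

theorem attainsGain_top {U : ℕ → ℝ} (d : ℕ) (lam : ℝ) {g : ℝ} (hg : ∀ j, U j ≤ g) :
    AttainsGain U d lam g ⊤ := by
  refine ⟨0, fun m => (Finset.sum_le_sum fun k _ => hg _).trans (le_of_eq ?_)⟩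
  simp [mul_comm]

theorem isConstrainedOptimal_of_le {U : ℕ → ℝ} (hU0 : U 0 = 0) (hU : ∀ j, 0 ≤ U j) {g : ℝ}
    (hg : 0 ≤ g) {lam : ℝ≥0} (hcycle : ∀ L : ℕ, g * L ≤ cycleCost U L + lam) {h b : ℝ}
    (hh : 0 < h) (hb : 0 < b) {d : ℕ} {μ : SensingPolicy}
    (hμ : μ.sensingRate h d ≤ ENNReal.ofReal b ∧
      μ.averageCost U d ≤ ENNReal.ofReal (g - lam * (b * h))) :
    IsConstrainedOptimal U h b d μ :=
  ⟨hμ.1, fun μ' hμ' =>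
    hμ.2.trans (μ'.ofReal_sub_le_averageCost d hU0 hU hg hcycle hh hb hμ')⟩

theorem AttainsGain.threshold_le {U : ℕ → ℝ} (hU : ∀ j, 0 ≤ U j) {d : ℕ} {lam g h b : ℝ}
    (hh : 0 < h) {η : ℕ∞} (hη : AttainsGain U d lam g η) (hr : sensingFrequency η = b * h) :
    (threshold η).sensingRate h d ≤ ENNReal.ofReal b ∧
      (threshold η).averageCost U d ≤ ENNReal.ofReal (g - lam * (b * h)) := by
  obtain ⟨K, hK⟩ := hη
  obtain ⟨K', hK'⟩ := exists_abs_sensings_sub_le η d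
  rw [hr] at hK hK'
  constructor
  · rw [threshold_eq_stationary, sensingRate_stationary_of_abs_le hh hK',
      mul_div_cancel_right₀ _ hh.ne']
  · rw [averageCost_eq, ← div_one (g - lam * (b * h))]
    refine limsup_div_le_of_le_linear (K := g - lam * (b * h) + K) one_pos fun m => ?_
    rw [threshold_eq_stationary, totalCost_stationary hU]
    refine ENNReal.ofReal_le_ofReal ((hK (m + 1)).trans (le_of_eq ?_))
    push_cast
    ring

/-- The mixture of two thresholds attains the dual bound if its mean sensing frequency is the
allowed one and the thresholds that are used with positive probability attain the same gain. -/
theorem mixedThreshold_le {U : ℕ → ℝ} (hU : ∀ j, 0 ≤ U j) {d : ℕ} {lam g h b q : ℝ} (hh : 0 < h)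
    {Ω : Type} [MeasurableSpace Ω] {ℙ : Measure Ω} [IsProbabilityMeasure ℙ] {ϑ : Ω → Bool}
    (hϑ : Measurable ϑ) (hq0 : 0 ≤ q) (hq1 : q ≤ 1)
    (hq : ℙ {ω | ϑ ω = true} = ENNReal.ofReal q) {η₁ η₂ : ℕ∞}
    (hr : q * sensingFrequency η₁ + (1 - q) * sensingFrequency η₂ = b * h)
    (h₁ : q ≠ 0 → AttainsGain U d lam g η₁) (h₂ : q ≠ 1 → AttainsGain U d lam g η₂) :
    (mixedThreshold ℙ ϑ hϑ η₁ η₂).sensingRate h d ≤ ENNReal.ofReal b ∧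
      (mixedThreshold ℙ ϑ hϑ η₁ η₂).averageCost U d ≤ ENNReal.ofReal (g - lam * (b * h)) := by
  have hq1' : 0 ≤ 1 - q := sub_nonneg.mpr hq1
  have weighted : ∀ {w : ℝ} {η : ℕ∞}, 0 ≤ w → (w ≠ 0 → AttainsGain U d lam g η) →
      ∃ K, ∀ m : ℕ, w * orbitSum (thresholdRule η) d U m
        ≤ w * (g - lam * sensingFrequency η) * m + K := by
    intro w η hw hη
    by_cases hw0 : w = 0
    · exact ⟨0, fun m => by simp [hw0]⟩
    · obtain ⟨K, hK⟩ := hη hw0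
      exact ⟨w * K, fun m => by linarith [mul_le_mul_of_nonneg_left (hK m) hw]⟩
  constructor
  · obtain ⟨K₁, hK₁⟩ := exists_abs_sensings_sub_le η₁ d
    obtain ⟨K₂, hK₂⟩ := exists_abs_sensings_sub_le η₂ d
    rw [sensingRate_eq, ← mul_div_cancel_right₀ b hh.ne']
    refine limsup_div_le_of_le_linear (K := b * h + (q * K₁ + (1 - q) * K₂)) hh fun m => ?_
    rw [totalSensings_mixedThreshold hϑ _ _ d hq0 hq1 hq]
    refine ENNReal.ofReal_le_ofReal ?_
    have e₁ := mul_le_mul_of_nonneg_left (abs_le.mp (hK₁ (m + 1))).2 hq0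
    have e₂ := mul_le_mul_of_nonneg_left (abs_le.mp (hK₂ (m + 1))).2 hq1'
    rw [← hr]
    push_cast at e₁ e₂
    linarith
  · obtain ⟨K₁, hK₁⟩ := weighted hq0 h₁
    obtain ⟨K₂, hK₂⟩ := weighted hq1' fun h => h₂ fun h' => h (by rw [h', sub_self])
    rw [averageCost_eq, ← div_one (g - lam * (b * h))]
    refine limsup_div_le_of_le_linear (K := g - lam * (b * h) + (K₁ + K₂)) one_pos fun m => ?_
    rw [totalCost_mixedThreshold hϑ _ _ d hq0 hq1 hq hU]
    refine ENNReal.ofReal_le_ofReal ?_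
    have e₁ := hK₁ (m + 1)
    have e₂ := hK₂ (m + 1)
    rw [← hr]
    push_cast at e₁ e₂
    linarith

/-! ### The dual function -/

theorem lagrangianCost_threshold_le {U : ℕ → ℝ} (hU : ∀ j, 0 ≤ U j) (d : ℕ) (lam : ℝ≥0) {N : ℕ}
    (hN : 0 < N) :
    (threshold N).lagrangianCost U lam d ≤ ENNReal.ofReal (cycleMean U lam N) := by
  obtain ⟨K, hK⟩ := attainsGain_natCast U d lam N
  obtain ⟨K', hK'⟩ := exists_abs_sensings_sub_le N d
  rw [max_eq_left (Nat.succ_le_of_lt hN)] at hK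
  rw [lagrangianCost_eq, ← div_one (cycleMean U lam N)]
  refine limsup_div_le_of_le_linear (K := cycleMean U lam N + K + lam * K') one_pos fun m => ?_
  rw [threshold_eq_stationary, totalCost_stationary hU, totalSensings_stationary,
    ← ENNReal.ofReal_coe_nnreal, ← ENNReal.ofReal_mul lam.coe_nonneg,
    ← ENNReal.ofReal_add (orbitSum_nonneg hU _ _)
      (mul_nonneg lam.coe_nonneg (orbitSum_nonneg (senseIndicator_nonneg _) _ _))]
  refine ENNReal.ofReal_le_ofReal ?_
  have e₁ := hK (m + 1)
  have e₂ := mul_le_mul_of_nonneg_left (abs_le.mp (hK' (m + 1))).2 lam.coe_nonneg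
  push_cast at e₁ e₂
  linarith

theorem dualValue_le {U : ℕ → ℝ} (hU : ∀ j, 0 ≤ U j) (h b : ℝ) (d : ℕ) (lam : ℝ≥0) {N : ℕ}
    (hN : 0 < N) : dualValue U h b d lam ≤ cycleMean U lam N - lam * (b * h) := by
  have hnn : 0 ≤ cycleMean U lam N :=
    div_nonneg (add_nonneg (Finset.sum_nonneg fun j _ => hU _) lam.coe_nonneg) N.cast_nonneg
  exact sub_le_sub_right (ENNReal.toReal_le_of_le_ofReal hnn
    ((iInf_le (fun μ : SensingPolicy => μ.lagrangianCost U lam d) (threshold N)).trans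
      (lagrangianCost_threshold_le hU d lam hN))) _

theorem IsOptimalLength.dualValue_eq {U : ℕ → ℝ} (hU0 : U 0 = 0) (hU : ∀ j, 0 ≤ U j)
    (hmono : Monotone U) (h b : ℝ) (d : ℕ) {lam : ℝ≥0} {N : ℕ} (hN : IsOptimalLength U lam N) :
    dualValue U h b d lam = cycleMean U lam N - lam * (b * h) := by
  refine le_antisymm (dualValue_le hU h b d lam hN.pos) (sub_le_sub_right ?_ _)
  refine (ENNReal.ofReal_le_iff_le_toReal ?_).mp (le_iInf fun μ => μ.ofReal_le_lagrangianCost d hU0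
    hU (hN.cycleMean_nonneg hU) (hN.cycleMean_mul_le hmono))
  exact ne_top_of_le_ne_top ENNReal.ofReal_ne_top
    ((iInf_le (fun μ : SensingPolicy => μ.lagrangianCost U lam d) (threshold N)).trans
      (lagrangianCost_threshold_le hU d lam hN.pos))

/-- A charge at which both a length that uses at least the budget and a length that uses at most
the budget are optimal maximizes the dual function: these lengths provide supergradients of either
sign. -/
theorem isOptimalMultiplier_of_isOptimalLength {U : ℕ → ℝ} (hU0 : U 0 = 0) (hU : ∀ j, 0 ≤ U j)
    (hmono : Monotone U) {h b : ℝ} (d : ℕ) {lam : ℝ≥0} {N N' : ℕ}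
    (hN : IsOptimalLength U lam N) (hN' : IsOptimalLength U lam N')
    (hNb : N * (b * h) ≤ 1) (hbN' : 1 ≤ N' * (b * h)) : IsOptimalMultiplier U h b d lam := by
  intro lam'
  have hpos : (0 : ℝ) < N := by exact_mod_cast hN.pos
  have hpos' : (0 : ℝ) < N' := by exact_mod_cast hN'.pos
  have hmean : ∀ L : ℕ, cycleMean U lam L - lam * (b * h) - (cycleMean U lam' L - lam' * (b * h))
      = (lam - lam') * (1 / L - b * h) := fun L => by simp only [cycleMean]; ring
  rcases le_total lam' lam with hle | hle
  · have hle' : (lam' : ℝ) ≤ lam := hle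
    have hr : b * h ≤ 1 / N := by rw [le_div_iff₀ hpos]; linarith
    rw [hN.dualValue_eq hU0 hU hmono]
    refine (dualValue_le hU h b d lam' hN.pos).trans (sub_nonneg.mp ?_)
    rw [hmean]
    exact mul_nonneg (by linarith) (by linarith)
  · have hle' : (lam : ℝ) ≤ lam' := hle
    have hr : 1 / N' ≤ b * h := by rw [div_le_iff₀ hpos']; linarith
    rw [hN'.dualValue_eq hU0 hU hmono]
    refine (dualValue_le hU h b d lam' hN'.pos).trans (sub_nonneg.mp ?_)
    rw [hmean]
    exact mul_nonneg_of_nonpos_of_nonpos (by linarith) (by linarith)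

/-! ### Brackets and optimal policies -/

/-- The cycle length at which the budget is exhausted. -/
theorem exists_cycleLength_of_budget {x : ℝ} (hx : 0 < x) (hx1 : x ≤ 1) :
    ∃ N : ℕ, 0 < N ∧ N * x ≤ 1 ∧ 1 < (N + 1 : ℕ) * x := by
  refine ⟨⌊1 / x⌋₊, Nat.floor_pos.mpr ((one_le_div hx).mpr hx1), ?_, ?_⟩
  · exact (le_div_iff₀ hx).mp (Nat.floor_le (by positivity))
  · push_cast
    exact (div_lt_iff₀ hx).mp (Nat.lt_floor_add_one _)

theorem exists_limitThreshold_below {U : ℕ → ℝ} (hU : ∀ j, 0 ≤ U j) (hmono : Monotone U) {N : ℕ}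
    (hN : 0 < N) {ε : ℝ} (hε : 0 < ε) :
    ∃ (lam : ℝ≥0) (k : ℕ), 0 < k ∧ k ≤ N ∧ IsLimitThreshold U lam k ∧
      (lam : ℝ) ≤ switchCharge U N ∧ switchCharge U N < lam + ε := by
  rcases (switchCharge_nonneg hmono N).eq_or_lt with h0 | h0
  · exact ⟨0, 1, one_pos, hN, isLimitThreshold_zero_one hU hmono, by simp [← h0],
      by simpa [← h0] using hε⟩
  classical
  -- The first length `k` with the same switching charge as `N` is optimal just below that charge.
  have hex : ∃ k, switchCharge U N ≤ switchCharge U k := ⟨N, le_rfl⟩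
  obtain ⟨k, hk⟩ : ∃ k, k = Nat.find hex := ⟨_, rfl⟩
  have hkspec : switchCharge U N ≤ switchCharge U k := hk ▸ Nat.find_spec hex
  have hkN : k ≤ N := hk ▸ Nat.find_min' hex le_rfl
  have hk0 : 0 < k := by
    rcases Nat.eq_zero_or_pos k with rfl | h
    · rw [switchCharge_zero] at hkspec; exact absurd hkspec (not_le.mpr h0)
    · exact h
  have hlt : switchCharge U (k - 1) < switchCharge U N :=
    not_le.mp (Nat.find_min hex (show k - 1 < Nat.find hex by omega))
  obtain ⟨x, hx1, hx2⟩ := exists_between (max_lt hlt (sub_lt_self (switchCharge U N) hε))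
  obtain ⟨hx3, hx4⟩ := max_lt_iff.mp hx1
  lift x to ℝ≥0 using (switchCharge_nonneg hmono (k - 1)).trans hx3.le
  refine ⟨x, k, hk0, hkN, isLimitThreshold_natCast hU hmono hk0 ?_ ?_, hx2.le, by linarith⟩
  · exact (lt_cycleMean_iff hk0).mpr hx3
  · exact (cycleMean_lt_iff hk0).mpr (hx2.trans_le hkspec)

theorem exists_limitThreshold_above {U : ℕ → ℝ} (hU : ∀ j, 0 ≤ U j) (hmono : Monotone U) (N : ℕ)
    {ε : ℝ} (hε : 0 < ε) :
    ∃ (lam : ℝ≥0) (η : ℕ∞), (N : ℕ∞) < η ∧ IsLimitThreshold U lam η ∧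
      switchCharge U N ≤ lam ∧ (lam : ℝ) < switchCharge U N + ε := by
  classical
  by_cases hex : ∃ k, switchCharge U N < switchCharge U k
  -- The first length `k` with a larger switching charge is optimal just above that of `N`.
  · obtain ⟨k, hk⟩ : ∃ k, k = Nat.find hex := ⟨_, rfl⟩
    have hkspec : switchCharge U N < switchCharge U k := hk ▸ Nat.find_spec hex
    have hNk : N < k := not_le.mp fun h => (switchCharge_mono hmono h).not_gt hkspec
    have hle : switchCharge U (k - 1) ≤ switchCharge U N :=
      not_lt.mp (Nat.find_min hex (show k - 1 < Nat.find hex by omega))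
    obtain ⟨x, hx1, hx2⟩ := exists_between (lt_min hkspec (lt_add_of_pos_right _ hε))
    obtain ⟨hx3, hx4⟩ := lt_min_iff.mp hx2
    lift x to ℝ≥0 using (switchCharge_nonneg hmono N).trans hx1.le
    have hk0 : 0 < k := by omega
    exact ⟨x, k, by exact_mod_cast hNk, isLimitThreshold_natCast hU hmono hk0
      ((lt_cycleMean_iff hk0).mpr (hle.trans_lt hx1)) ((cycleMean_lt_iff hk0).mpr hx3),
      hx1.le, hx4⟩
  · push Not at hex
    refine ⟨NNReal.mk (switchCharge U N) (switchCharge_nonneg hmono N), ⊤, ENat.natCast_lt_top N, ?_, le_rfl,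
      lt_add_of_pos_right _ hε⟩
    have hopt := isOptimalLength_switchCharge_succ hmono N
    refine isLimitThreshold_of_eventually ?_
    filter_upwards [Ioo_mem_nhdsLT (zero_lt_one' ℝ)] with β hβ
    refine isDiscountOptimalThreshold_top hU hmono hβ.1.le hβ.2
      (hopt.le_cycleMean_of_forall_le hmono hex) fun n => ?_
    have := hopt.cycleMean_mul_le hmono n
    rw [Finset.sum_sub_distrib, Finset.sum_const, Finset.card_range, nsmul_eq_mul,
      NNReal.coe_mk]
    rw [cycleCost] at this
    linarith

theorem exists_isBracket {U : ℕ → ℝ} (hU : ∀ j, 0 ≤ U j) (hmono : Monotone U) {h b : ℝ}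
    (hh : 0 < h) (hb : 0 < b) (hbh : b * h ≤ 1) (d : ℕ) {ε : ℝ} (hε : 0 < ε) :
    ∃ (lam₁ lam₂ : ℝ≥0) (η₁ η₂ : ℕ∞), IsBracket U h b d ε lam₁ lam₂ η₁ η₂ ∧
      budgetUsed h d η₂ < budgetUsed h d η₁ := by
  have hx := mul_pos hb hh
  obtain ⟨N, hN, hNx, hxN⟩ := exists_cycleLength_of_budget hx hbh
  obtain ⟨lam₁, k, hk0, hkN, hlim₁, h1, h1'⟩ :=
    exists_limitThreshold_below hU hmono hN (half_pos hε)
  obtain ⟨lam₂, η, hη, hlim₂, h2, h2'⟩ := exists_limitThreshold_above hU hmono N (half_pos hε)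
  have hr₁ : b ≤ budgetUsed h d k := by
    have hkpos : (0 : ℝ) < k := by exact_mod_cast hk0
    have hkN' : (k : ℝ) ≤ N := by exact_mod_cast hkN
    rw [budgetUsed_eq hh, le_div_iff₀ hh, sensingFrequency_coe,
      max_eq_left (Nat.succ_le_of_lt hk0), le_div_iff₀ hkpos, mul_comm]
    exact (mul_le_mul_of_nonneg_right hkN' hx.le).trans hNx
  have hr₂ : budgetUsed h d η < b := by
    rw [budgetUsed_eq hh, div_lt_iff₀ hh]
    induction η using ENat.recTopCoe with
    | top => simpa using hx
    | coe m =>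
      have hm : N + 1 ≤ m := by exact_mod_cast hη
      have hm' : ((N + 1 : ℕ) : ℝ) ≤ m := by exact_mod_cast hm
      have hmpos : (0 : ℝ) < m := by exact_mod_cast (show 0 < m by omega)
      rw [sensingFrequency_coe, max_eq_left (by omega), div_lt_iff₀ hmpos, mul_comm]
      exact hxN.trans_le (mul_le_mul_of_nonneg_right hm' hx.le)
  exact ⟨lam₁, lam₂, k, η, ⟨NNReal.coe_le_coe.mp (h1.trans h2), by linarith, hlim₁, hlim₂, hr₂.le,
    hr₁⟩, hr₂.trans_le hr₁⟩

/-- What a bracket says about cycle lengths: the first threshold has a finite cycle length that is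
optimal at `lam₁` and uses at least the budget, while the second one is `⊤` or has a cycle length
that is optimal at `lam₂` and uses at most the budget. -/
theorem IsBracket.exists_lengths {U : ℕ → ℝ} (hU : ∀ j, 0 ≤ U j) (hmono : Monotone U) {h b : ℝ}
    (hh : 0 < h) (hb : 0 < b) {d : ℕ} {ε : ℝ} {lam₁ lam₂ : ℝ≥0} {η₁ η₂ : ℕ∞}
    (hB : IsBracket U h b d ε lam₁ lam₂ η₁ η₂) :
    (∃ k : ℕ, η₁ = k ∧ IsOptimalLength U lam₁ (max k 1) ∧ (max k 1 : ℕ) * (b * h) ≤ 1) ∧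
    ((η₂ = ⊤ ∧ ∀ M, switchCharge U M ≤ lam₂) ∨
      ∃ k : ℕ, η₂ = k ∧ IsOptimalLength U lam₂ (max k 1) ∧ 1 ≤ (max k 1 : ℕ) * (b * h)) := by
  obtain ⟨-, -, hlim₁, hlim₂, hb₂, hb₁⟩ := hB
  rw [budgetUsed_eq hh, le_div_iff₀ hh] at hb₁
  rw [budgetUsed_eq hh, div_le_iff₀ hh] at hb₂
  constructor
  · induction η₁ using ENat.recTopCoe with
    | top =>
      rw [sensingFrequency_top] at hb₁
      exact absurd hb₁ (not_le.mpr (mul_pos hb hh))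
    | coe k =>
      refine ⟨k, rfl, hlim₁.isOptimalLength hU hmono, ?_⟩
      rwa [sensingFrequency_coe, le_div_iff₀ (by positivity), mul_comm] at hb₁
  · induction η₂ using ENat.recTopCoe with
    | top => exact Or.inl ⟨rfl, hlim₂.switchCharge_le hU hmono⟩
    | coe k =>
      refine Or.inr ⟨k, rfl, hlim₂.isOptimalLength hU hmono, ?_⟩
      rwa [sensingFrequency_coe, div_le_iff₀ (by positivity), mul_comm] at hb₂

theorem le_of_mul_le_one {x : ℝ} (hx : 0 < x) {N M : ℕ} (hN : 1 < (N + 1 : ℕ) * x)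
    (hM : M * x ≤ 1) : M ≤ N := by
  by_contra hcon
  have : ((N + 1 : ℕ) : ℝ) ≤ M := by exact_mod_cast not_le.mp hcon
  linarith [mul_le_mul_of_nonneg_right this hx.le]

theorem le_of_one_le_mul {x : ℝ} (hx : 0 < x) {N M : ℕ} (hN : N * x ≤ 1) (hM : 1 ≤ M * x) :
    N ≤ M := by
  by_contra hcon
  have : (M : ℝ) < N := by exact_mod_cast not_le.mp hcon
  linarith [mul_lt_mul_of_pos_right this hx]

theorem lt_of_one_lt_mul {x : ℝ} (hx : 0 < x) {N M : ℕ} (hN : N * x ≤ 1) (hM : 1 < M * x) :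
    N < M := by
  by_contra hcon
  have : (M : ℝ) ≤ N := by exact_mod_cast not_lt.mp hcon
  linarith [mul_le_mul_of_nonneg_right this hx.le]

theorem IsBracket.exists_isOptimalMultiplier {U : ℕ → ℝ} (hU0 : U 0 = 0) (hU : ∀ j, 0 ≤ U j)
    (hmono : Monotone U) {h b : ℝ} (hh : 0 < h) (hb : 0 < b) (hbh : b * h ≤ 1) {d : ℕ} {ε : ℝ}
    {lam₁ lam₂ : ℝ≥0} {η₁ η₂ : ℕ∞} (hB : IsBracket U h b d ε lam₁ lam₂ η₁ η₂) :
    ∃ lam : ℝ≥0, lam₁ ≤ lam ∧ lam ≤ lam₂ ∧ IsOptimalMultiplier U h b d lam := by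
  have hx := mul_pos hb hh
  obtain ⟨N, hN, hNx, hxN⟩ := exists_cycleLength_of_budget hx hbh
  obtain ⟨⟨k₁, -, hopt₁, hk₁⟩, hη₂⟩ := hB.exists_lengths hU hmono hh hb
  have hT := switchCharge_mono hmono
  by_cases hle : switchCharge U N ≤ lam₂
  · refine ⟨NNReal.mk (switchCharge U N) (switchCharge_nonneg hmono N),
      NNReal.coe_le_coe.mp (hopt₁.upp.trans (hT (le_of_mul_le_one hx hxN hk₁))),
      NNReal.coe_le_coe.mp hle, ?_⟩
    exact isOptimalMultiplier_of_isOptimalLength hU0 hU hmono d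
      (isOptimalLength_switchCharge hmono hN) (isOptimalLength_switchCharge_succ hmono N) hNx
      hxN.le
  -- If `lam₂` is below the switching charge, the second threshold itself exhausts the budget.
  · obtain ⟨-, hall⟩ | ⟨k₂, -, hopt₂, hk₂⟩ := hη₂
    · exact absurd (hall N) hle
    · have hle₂ : max k₂ 1 ≤ N := by
        by_contra hcon
        exact hle ((hT (show N ≤ max k₂ 1 - 1 by omega)).trans hopt₂.low)
      have heq : max k₂ 1 = N := le_antisymm hle₂ (le_of_one_le_mul hx hNx hk₂)
      refine ⟨lam₂, hB.le, le_rfl,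
        isOptimalMultiplier_of_isOptimalLength hU0 hU hmono d hopt₂ hopt₂ ?_ hk₂⟩
      rw [heq]
      exact hNx

theorem isConstrainedOptimal_threshold {U : ℕ → ℝ} (hU0 : U 0 = 0) (hU : ∀ j, 0 ≤ U j)
    (hmono : Monotone U) {h b : ℝ} (hh : 0 < h) (hb : 0 < b) (d : ℕ) {lam : ℝ≥0} {k : ℕ}
    (hopt : IsOptimalLength U lam (max k 1)) (hr : sensingFrequency k = b * h) :
    IsConstrainedOptimal U h b d (threshold k) :=
  isConstrainedOptimal_of_le hU0 hU (hopt.cycleMean_nonneg hU) (hopt.cycleMean_mul_le hmono) hh hb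
    ((attainsGain_natCast U d lam k).threshold_le hU hh hr)

/-- If a short bracket does not have the budget itself as its lower end, both thresholds attain the
optimal gain at one and the same charge, namely the switching charge of the longest cycle that uses
at least the budget. -/
theorem IsBracket.exists_common_gain {U : ℕ → ℝ} (hU : ∀ j, 0 ≤ U j) (hmono : Monotone U)
    {h b : ℝ} (hh : 0 < h) (hb : 0 < b) {d N : ℕ} {ε : ℝ}
    (hNx : N * (b * h) ≤ 1) (hxN : 1 < (N + 1 : ℕ) * (b * h))
    (hgap : ∀ M, switchCharge U N < switchCharge U M + ε →
      switchCharge U M < switchCharge U N + ε → switchCharge U M = switchCharge U N)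
    {lam₁ lam₂ : ℝ≥0} {η₁ η₂ : ℕ∞} (hB : IsBracket U h b d ε lam₁ lam₂ η₁ η₂)
    (hη₂ : sensingFrequency η₂ < b * h) :
    ∃ N' : ℕ, IsOptimalLength U (switchCharge U N) N' ∧
      AttainsGain U d (switchCharge U N) (cycleMean U (switchCharge U N) N') η₁ ∧
      AttainsGain U d (switchCharge U N) (cycleMean U (switchCharge U N) N') η₂ := by
  have hx := mul_pos hb hh
  have hT := switchCharge_mono hmono
  obtain ⟨⟨k₁, rfl, hopt₁, hk₁⟩, hcase⟩ := hB.exists_lengths hU hmono hh hb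
  have hlt := hB.lt
  have hN₁ := hT (le_of_mul_le_one hx hxN hk₁)
  have hupp := hopt₁.upp
  have hlt₂ : ∀ k₂ : ℕ, η₂ = k₂ → N < max k₂ 1 := by
    rintro k₂ rfl
    rw [sensingFrequency_coe, div_lt_iff₀ (by positivity), mul_comm] at hη₂
    exact lt_of_one_lt_mul hx hNx hη₂
  have bound : ∀ M, N ≤ M → switchCharge U M ≤ lam₂ → switchCharge U M = switchCharge U N :=
    fun M hM hM₂ => hgap M (by linarith [hT hM, hB.le, NNReal.coe_le_coe.mpr hB.le])
      (by linarith)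
  have hNle : switchCharge U N ≤ lam₂ := by
    obtain ⟨-, hall⟩ | ⟨k₂, hη, hopt₂, -⟩ := hcase
    · exact hall N
    · have := hlt₂ k₂ hη
      exact (hT (show N ≤ max k₂ 1 - 1 by omega)).trans hopt₂.low
  have heq₁ : switchCharge U (max k₁ 1) = switchCharge U N :=
    hgap _ (by linarith) (by linarith [NNReal.coe_le_coe.mpr hB.le])
  have hopt₁' : IsOptimalLength U (switchCharge U N) (max k₁ 1) :=
    ⟨hopt₁.pos, (hT (by omega)).trans heq₁.le, heq₁.ge⟩
  refine ⟨max k₁ 1, hopt₁', attainsGain_natCast _ _ _ _, ?_⟩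
  obtain ⟨rfl, hall⟩ | ⟨k₂, hη, hopt₂, -⟩ := hcase
  · refine attainsGain_top d _ (hopt₁'.le_cycleMean_of_forall_le hmono fun M => ?_)
    rcases le_total N M with hM | hM
    · exact (bound M hM (hall M)).le
    · exact hT hM
  · have hN₂ := hlt₂ k₂ hη
    have hopt₂' : IsOptimalLength U (switchCharge U N) (max k₂ 1) :=
      ⟨hopt₂.pos, (bound _ (by omega) hopt₂.low).le, hT hN₂.le⟩
    rw [hopt₁'.cycleMean_eq hopt₂' hmono, hη]
    exact attainsGain_natCast _ _ _ _

theorem IsBracket.isConstrainedOptimal_mixedThreshold {U : ℕ → ℝ} (hU0 : U 0 = 0)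
    (hU : ∀ j, 0 ≤ U j) (hmono : Monotone U) {h b : ℝ} (hh : 0 < h) (hb : 0 < b) {d N : ℕ} {ε : ℝ}
    (hNx : N * (b * h) ≤ 1) (hxN : 1 < (N + 1 : ℕ) * (b * h))
    (hgap : ∀ M, switchCharge U N < switchCharge U M + ε →
      switchCharge U M < switchCharge U N + ε → switchCharge U M = switchCharge U N)
    {lam₁ lam₂ : ℝ≥0} {η₁ η₂ : ℕ∞} (hB : IsBracket U h b d ε lam₁ lam₂ η₁ η₂)
    (hlt : budgetUsed h d η₂ < budgetUsed h d η₁)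
    {Ω : Type} [MeasurableSpace Ω] {ℙ : Measure Ω} [IsProbabilityMeasure ℙ] {ϑ : Ω → Bool}
    (hϑ : Measurable ϑ) (hq : ℙ {ω | ϑ ω = true} = ENNReal.ofReal
      ((b - budgetUsed h d η₂) / (budgetUsed h d η₁ - budgetUsed h d η₂))) :
    IsConstrainedOptimal U h b d (mixedThreshold ℙ ϑ hϑ η₁ η₂) := by
  have hx := mul_pos hb hh
  have hb₁ := hB.le_budget₁
  have hb₂ := hB.budget₂_le
  have hD : 0 < budgetUsed h d η₁ - budgetUsed h d η₂ := sub_pos.mpr hlt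
  have hr : ∀ η, sensingFrequency η = budgetUsed h d η * h := fun η => by
    rw [budgetUsed_eq hh, div_mul_cancel₀ _ hh.ne']
  have hr₁ := hr η₁
  have hr₂ := hr η₂
  set b₁ := budgetUsed h d η₁
  set b₂ := budgetUsed h d η₂
  set q := (b - b₂) / (b₁ - b₂) with hqdef
  have hq0 : 0 ≤ q := div_nonneg (by linarith) hD.le
  have hq1 : q ≤ 1 := (div_le_one hD).mpr (by linarith)
  have hmix : q * sensingFrequency η₁ + (1 - q) * sensingFrequency η₂ = b * h := by
    have : q * (b₁ - b₂) = b - b₂ := div_mul_cancel₀ _ hD.ne'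
    rw [hr₁, hr₂]
    linear_combination h * this
  obtain ⟨⟨k₁, hη₁, hopt₁, -⟩, hcase⟩ := hB.exists_lengths hU hmono hh hb
  -- If one threshold exhausts the budget, the other one has probability zero and plays no role.
  rcases hb₁.eq_or_lt with h1 | h1
  · have hqone : q = 1 := by rw [hqdef, ← h1, div_self]; rw [h1]; exact hD.ne'
    exact isConstrainedOptimal_of_le hU0 hU (hopt₁.cycleMean_nonneg hU)
      (hopt₁.cycleMean_mul_le hmono) hh hb (mixedThreshold_le hU hh hϑ hq0 hq1 hq hmix
        (fun _ => hη₁ ▸ attainsGain_natCast U d lam₁ k₁) fun h => absurd hqone h)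
  rcases hb₂.eq_or_lt with h2 | h2
  · have hqzero : q = 0 := by rw [hqdef, h2, sub_self, zero_div]
    obtain ⟨htop, -⟩ | ⟨k₂, hη₂, hopt₂, -⟩ := hcase
    · rw [htop, sensingFrequency_top, h2] at hr₂
      exact absurd hr₂ hx.ne
    · exact isConstrainedOptimal_of_le hU0 hU (hopt₂.cycleMean_nonneg hU)
        (hopt₂.cycleMean_mul_le hmono) hh hb (mixedThreshold_le hU hh hϑ hq0 hq1 hq hmix
          (fun h => absurd hqzero h) fun _ => hη₂ ▸ attainsGain_natCast U d lam₂ k₂)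
  · obtain ⟨N', hN', hg₁, hg₂⟩ := hB.exists_common_gain hU hmono hh hb hNx hxN hgap
      (by rw [hr₂]; exact mul_lt_mul_of_pos_right h2 hh)
    exact isConstrainedOptimal_of_le (lam := NNReal.mk (switchCharge U N) (switchCharge_nonneg hmono N)) hU0 hU
      (hN'.cycleMean_nonneg hU) (hN'.cycleMean_mul_le hmono) hh hb
      (mixedThreshold_le hU hh hϑ hq0 hq1 hq hmix (fun _ => hg₁) fun _ => hg₂)

theorem IsBracket.isConstrainedOptimal_of_eq {U : ℕ → ℝ} (hU0 : U 0 = 0) (hU : ∀ j, 0 ≤ U j)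
    (hmono : Monotone U) {h b : ℝ} (hh : 0 < h) (hb : 0 < b) {d : ℕ} {ε : ℝ}
    {lam₁ lam₂ : ℝ≥0} {η₁ η₂ : ℕ∞} (hB : IsBracket U h b d ε lam₁ lam₂ η₁ η₂)
    (heq : budgetUsed h d η₂ = budgetUsed h d η₁) :
    IsConstrainedOptimal U h b d (threshold η₁) ∧
      IsConstrainedOptimal U h b d (threshold η₂) := by
  have h1 : budgetUsed h d η₁ = b := le_antisymm (heq ▸ hB.budget₂_le) hB.le_budget₁
  have h2 : budgetUsed h d η₂ = b := heq.trans h1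
  rw [budgetUsed_eq hh, div_eq_iff hh.ne'] at h1 h2
  obtain ⟨⟨k₁, rfl, hopt₁, -⟩, hcase⟩ := hB.exists_lengths hU hmono hh hb
  refine ⟨isConstrainedOptimal_threshold hU0 hU hmono hh hb d hopt₁ h1, ?_⟩
  obtain ⟨rfl, -⟩ | ⟨k₂, rfl, hopt₂, -⟩ := hcase
  · exact absurd h2 (mul_pos hb hh).ne
  · exact isConstrainedOptimal_threshold hU0 hU hmono hh hb d hopt₂ h2

/-! ### Stationary deterministic policies -/

/-- A rule `f` either has a cycle length that its ages end up repeating, or its age after `k` steps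
is at least `k`, since no sensing takes place except possibly at the age `0`. -/
theorem exists_isCycleLength_or_le_iterate (f : ℕ → Bool) (d : ℕ) :
    (∃ L k₀, IsCycleLength f L ∧ (nextAge f)^[k₀] d = 1) ∨ ∀ k, k ≤ (nextAge f)^[k] d := by
  classical
  by_cases hsense : ∃ i, f (d + i) = true
  · obtain ⟨i, hi⟩ := hsense
    obtain ⟨k₀, hk₀⟩ := exists_iterate_nextAge_eq_one i d hi
    by_cases hex : ∃ j, 0 < j ∧ f j = true
    · refine Or.inl ⟨Nat.find hex, k₀, ⟨(Nat.find_spec hex).1, (Nat.find_spec hex).2,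
        fun j hj hlt => ?_⟩, hk₀⟩
      simpa [hj] using Nat.find_min hex hlt
    · have hfalse : ∀ j, 0 < j → f j = false := fun j hj => by
        by_contra hcon
        exact hex ⟨j, hj, by simpa using hcon⟩
      right
      intro k
      rcases k with _ | k
      · exact Nat.zero_le _
      · have hd : d = 0 := by
          by_contra hd
          rw [hfalse (d + i) (by omega)] at hi
          exact absurd hi (by simp)
        subst hd
        have hnext : nextAge f 0 = 1 := by simp [nextAge]
        rw [Function.iterate_succ_apply, hnext,
          iterate_nextAge_of_forall_false fun i => hfalse (1 + i) (by omega)]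
        omega
  · right
    intro k
    rw [iterate_nextAge_of_forall_false fun i => by
      by_contra hcon
      exact hsense ⟨i, by simpa using hcon⟩]
    omega

theorem le_averageCost_stationary {U : ℕ → ℝ} (hU : ∀ j, 0 ≤ U j) {f : ℕ → Bool} {d : ℕ} {x K : ℝ}
    (hK : ∀ m : ℕ, x * m - K ≤ orbitSum f d U m) :
    ENNReal.ofReal x ≤ (stationary f).averageCost U d := by
  rw [averageCost_eq, ← div_one x]
  refine le_limsup_div_of_linear_le (K := x - K) one_pos (Eventually.of_forall fun m => ?_)
  rw [totalCost_stationary hU]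
  refine ENNReal.ofReal_le_ofReal (le_trans (le_of_eq ?_) (hK (m + 1)))
  push_cast
  ring

/-- If cycles of length `N` exceed the budget, every stationary deterministic policy that respects
it has cycles of length `N + 1` at least, and costs accordingly. -/
theorem le_averageCost_of_sensingRate_le {U : ℕ → ℝ} (hU : ∀ j, 0 ≤ U j) (hmono : Monotone U)
    {h b : ℝ} (hh : 0 < h) (hb : 0 < b) {d N : ℕ} (hNx : N * (b * h) < 1) {f : ℕ → Bool}
    (hf : (stationary f).sensingRate h d ≤ ENNReal.ofReal b) :
    ENNReal.ofReal (cycleCost U (N + 1) / (N + 1 : ℕ)) ≤ (stationary f).averageCost U d := by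
  have hx := mul_pos hb hh
  have hN1 : (0 : ℝ) < (N + 1 : ℕ) := by positivity
  obtain ⟨L, k₀, hL, hk₀⟩ | hle := exists_isCycleLength_or_le_iterate f d
  · have hLpos : (0 : ℝ) < L := by exact_mod_cast hL.pos
    obtain ⟨K, hK⟩ := hL.exists_abs_sum_sub_le hk₀ U
    obtain ⟨K', hK'⟩ := hL.exists_abs_sum_sub_le hk₀ (senseIndicator f)
    rw [sensingRate_stationary_of_abs_le hh hK', hL.cycleCost_senseIndicator,
      ENNReal.ofReal_le_ofReal_iff hb.le, div_le_iff₀ hh, div_le_iff₀ hLpos] at hf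
    have hNL : N + 1 ≤ L := by
      by_contra hcon
      have : (L : ℝ) ≤ N := by exact_mod_cast (show L ≤ N by omega)
      linarith [mul_le_mul_of_nonneg_right this hx.le]
    have hNL' : ((N + 1 : ℕ) : ℝ) ≤ L := by exact_mod_cast hNL
    have hmean : cycleCost U (N + 1) / (N + 1 : ℕ) ≤ cycleCost U L / L := by
      -- The length `N + 1` is optimal at the switching charge of `N`, and `L` senses less often.
      have hopt := isOptimalLength_switchCharge_succ hmono N
      have h1 := hopt.cycleMean_mul_le hmono L
      rw [cycleMean, add_div, add_mul] at h1
      have h2 : switchCharge U N ≤ switchCharge U N / (N + 1 : ℕ) * L := by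
        rw [div_mul_eq_mul_div, le_div_iff₀ hN1]
        exact mul_le_mul_of_nonneg_left hNL' (switchCharge_nonneg hmono N)
      rw [le_div_iff₀ hLpos]
      linarith
    refine (ENNReal.ofReal_le_ofReal hmean).trans
      (le_averageCost_stationary (K := K) hU fun m => ?_)
    have := (abs_le.mp (hK m)).1
    rw [orbitSum]
    linarith
  · have hmean : cycleCost U (N + 1) / (N + 1 : ℕ) ≤ U (N + 1) := by
      rw [div_le_iff₀ hN1, cycleCost, mul_comm, ← nsmul_eq_mul]
      refine (Finset.sum_le_card_nsmul _ _ (U (N + 1)) fun j hj => hmono ?_).trans_eq (by simp)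
      have := Finset.mem_range.mp hj
      omega
    refine (ENNReal.ofReal_le_ofReal hmean).trans
      (le_averageCost_stationary (K := (N + 1 : ℕ) * U (N + 1)) hU fun m => ?_)
    induction m with
    | zero =>
      simpa [orbitSum] using mul_nonneg hN1.le (hU (N + 1))
    | succ m ih =>
      rcases lt_or_ge m (N + 1) with hm | hm
      · have hm' : ((m + 1 : ℕ) : ℝ) ≤ (N + 1 : ℕ) := by exact_mod_cast hm
        have := mul_le_mul_of_nonneg_right hm' (hU (N + 1))
        linarith [orbitSum_nonneg hU (f := f) d (m + 1)]
      · have h1 := hmono (hm.trans (hle m))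
        have h2 : orbitSum f d U (m + 1) = orbitSum f d U m + U ((nextAge f)^[m] d) :=
          Finset.sum_range_succ _ _
        rw [h2]
        push_cast at ih ⊢
        linarith

theorem not_isConstrainedOptimal_stationary {U : ℕ → ℝ} (hU : ∀ j, 0 ≤ U j)
    (hmono : Monotone U) {h b : ℝ} (hh : 0 < h) (hb : 0 < b) (hbh : b * h ≤ 1) (d : ℕ)
    (hint : ∀ N : ℕ, b * h * N ≠ 1) (hU12 : U 1 < U 2) (f : ℕ → Bool) :
    ¬ IsConstrainedOptimal U h b d (stationary f) := by
  rintro ⟨hfeas, hbest⟩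
  have hx := mul_pos hb hh
  obtain ⟨N, hN, hNx, hxN⟩ := exists_cycleLength_of_budget hx hbh
  replace hNx : N * (b * h) < 1 := lt_of_le_of_ne hNx (by rw [mul_comm]; exact hint N)
  have hNpos : (0 : ℝ) < N := by exact_mod_cast hN
  have hN1 : (0 : ℝ) < (N + 1 : ℕ) := by positivity
  set T := switchCharge U N
  have hTpos : 0 < T := by
    have h1 : switchCharge U 1 = U 2 - U 1 := by simp [switchCharge, cycleCost]
    have := switchCharge_mono hmono (Nat.succ_le_of_lt hN)
    rw [Nat.succ_eq_add_one, zero_add, h1] at this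
    linarith
  -- The mixture of the thresholds `N` and `N + 1` that exhausts the budget is a better policy.
  set q : ℝ := (b * h - 1 / (N + 1 : ℕ)) / (1 / N - 1 / (N + 1 : ℕ))
  have hr₁ : b * h < 1 / N := by rw [lt_div_iff₀ hNpos]; linarith
  have hr₂ : 1 / ((N + 1 : ℕ) : ℝ) < b * h := by rw [div_lt_iff₀ hN1]; linarith
  have hD : (0 : ℝ) < 1 / N - 1 / (N + 1 : ℕ) := by linarith
  have hq0 : 0 ≤ q := div_nonneg (by linarith) hD.le
  have hq1 : q ≤ 1 := (div_le_one hD).mpr (by linarith)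
  let ℙ : Measure Bool :=
    ENNReal.ofReal q • Measure.dirac true + ENNReal.ofReal (1 - q) • Measure.dirac false
  have hℙ : IsProbabilityMeasure ℙ := ⟨by
    simp [ℙ, ← ENNReal.ofReal_add hq0 (sub_nonneg.mpr hq1)]⟩
  have hprob : ℙ {ω | id ω = true} = ENNReal.ofReal q := by
    simp [ℙ]
  have hmix : q * sensingFrequency (N : ℕ) + (1 - q) * sensingFrequency (N + 1 : ℕ) = b * h := by
    have : q * (1 / N - 1 / (N + 1 : ℕ)) = b * h - 1 / (N + 1 : ℕ) := div_mul_cancel₀ _ hD.ne'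
    rw [sensingFrequency_coe, sensingFrequency_coe, max_eq_left (by omega),
      max_eq_left (by omega)]
    linear_combination this
  have hoptN := isOptimalLength_switchCharge hmono hN
  have hopt := isOptimalLength_switchCharge_succ hmono N
  have hg₁ := attainsGain_natCast U d T N
  have hg₂ := attainsGain_natCast U d T (N + 1)
  rw [max_eq_left (by omega)] at hg₁ hg₂
  rw [hoptN.cycleMean_eq hopt hmono] at hg₁
  obtain ⟨hmixfeas, hmixcost⟩ := mixedThreshold_le (ℙ := ℙ) hU hh measurable_id hq0 hq1 hprob hmix
    (fun _ => hg₁) fun _ => hg₂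
  have hle := ((le_averageCost_of_sensingRate_le hU hmono hh hb hNx hfeas).trans
    (hbest _ hmixfeas)).trans hmixcost
  rw [ENNReal.ofReal_le_ofReal_iff'] at hle
  rcases hle with hle | hle
  · rw [cycleMean, add_div, div_eq_mul_one_div T] at hle
    have := mul_lt_mul_of_pos_left hr₂ hTpos
    linarith
  · have h2 : 0 < U (N + 1) := ((hU 1).trans_lt hU12).trans_le (hmono (by omega))
    have h3 : 0 ≤ cycleCost U N := Finset.sum_nonneg fun j _ => hU _
    refine absurd hle (not_le.mpr (div_pos ?_ hN1))
    rw [cycleCost_succ]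
    linarith

end SensingGame

open SensingGame SensingPolicy in
theorem proposition2 {n m₁ m₂ p : ℕ} (S : LQGame n m₁ m₂ p) (P : Matrix (Fin n) (Fin n) ℝ)
    (hP : S.IsMinimalRiccatiSolution P) (h b : ℝ) (hh : 0 < h) (hb : 0 < b) (hbh : b * h ≤ 1)
    (d : ℕ) :
    -- brackets with two distinct budgets exist for every tolerance
    (∀ ε : ℝ, 0 < ε → ∃ (lam₁ lam₂ : ℝ≥0) (η₁ η₂ : ℕ∞),
      IsBracket (S.ageCost P h) h b d ε lam₁ lam₂ η₁ η₂ ∧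
        budgetUsed h d η₂ < budgetUsed h d η₁) ∧
    -- for every small enough tolerance, each bracket contains an optimal multiplier and its
    -- randomized threshold policy solves the constrained problem
    (∃ ε₀ : ℝ, 0 < ε₀ ∧ ∀ (lam₁ lam₂ : ℝ≥0) (η₁ η₂ : ℕ∞),
      IsBracket (S.ageCost P h) h b d ε₀ lam₁ lam₂ η₁ η₂ →
        (∃ lam : ℝ≥0, lam₁ ≤ lam ∧ lam ≤ lam₂ ∧
          IsOptimalMultiplier (S.ageCost P h) h b d lam) ∧
        (budgetUsed h d η₂ < budgetUsed h d η₁ →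
          ∀ (Ω : Type) [MeasurableSpace Ω] (ℙ : Measure Ω) [IsProbabilityMeasure ℙ]
            (ϑ : Ω → Bool) (hϑ : Measurable ϑ),
            ℙ {ω | ϑ ω = true} = ENNReal.ofReal
              ((b - budgetUsed h d η₂) / (budgetUsed h d η₁ - budgetUsed h d η₂)) →
            IsConstrainedOptimal (S.ageCost P h) h b d (mixedThreshold ℙ ϑ hϑ η₁ η₂)) ∧
        (budgetUsed h d η₂ = budgetUsed h d η₁ →
          IsConstrainedOptimal (S.ageCost P h) h b d (threshold η₁) ∧
          IsConstrainedOptimal (S.ageCost P h) h b d (threshold η₂))) ∧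
    -- randomization is needed in general
    ((∀ N : ℕ, b * h * N ≠ 1) → S.ageCost P h 1 < S.ageCost P h 2 →
      ∀ f : ℕ → Bool, ¬ IsConstrainedOptimal (S.ageCost P h) h b d (stationary f)) := by
  have hU0 : S.ageCost P h 0 = 0 := S.ageCost_zero h
  have hmono : Monotone (S.ageCost P h) := S.monotone_ageCost hP.1.1 hh.le
  have hU : ∀ j, 0 ≤ S.ageCost P h j := fun j => hU0 ▸ hmono (Nat.zero_le j)
  obtain ⟨N, -, hNx, hxN⟩ := exists_cycleLength_of_budget (mul_pos hb hh) hbh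
  obtain ⟨ε₀, hε₀, hgap⟩ := exists_gap (switchCharge_mono hmono) N
  refine ⟨fun ε hε => exists_isBracket hU hmono hh hb hbh d hε, ⟨ε₀, hε₀, ?_⟩,
    fun hint hU12 => not_isConstrainedOptimal_stationary hU hmono hh hb hbh d hint hU12⟩
  intro lam₁ lam₂ η₁ η₂ hB
  refine ⟨hB.exists_isOptimalMultiplier hU0 hU hmono hh hb hbh, ?_,
    hB.isConstrainedOptimal_of_eq hU0 hU hmono hh hb⟩
  intro hlt Ω _ ℙ _ ϑ hϑ hq
  exact hB.isConstrainedOptimal_mixedThreshold hU0 hU hmono hh hb hNx hxN hgap hlt hϑ hq
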